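/- **Setting.** $H^2(\mathbb D;E)$ is the Hilbert space of analytic functions on $\mathbb D$, with values in the Hilbert space $E$, whose Taylor coefficients are square-summable (with the $\ell^2$ inner product of the coefficients); $H^2=H^2(\mathbb D)=H^2(\mathbb D;\mathbb C)$, and $H^2(\mathbb D^2)$ is defined likewise on the bidisc. A function $\Psi\in H^\infty(\mathbb D;\mathcal B(E,F))$ (bounded analytic, operator-valued) is *inner* if multiplication by $\Psi$ is an isometry $H^2(\mathbb D;E)\to H^2(\mathbb D;F)$; a scalar inner function $\varphi\in H^\infty(\mathbb D)$ is the case $E=F=\mathbb C$, and $K_\varphi:=H^2\ominus\varphi H^2$. For a one-variable function $f$ put $f_{z_2}(z_1,z_2):=f(z_2)$, and let $H^2_{z_1}$ be the set of functions $(z_1,z_2)\mapsto h(z_1)$ with $h\in H^2$. For $\Psi\in H^\infty(\mathbb D;\mathcal B(\mathcal E,K_\varphi))$, the space $\Psi H^2(\mathbb D;\mathcal E)\subseteq H^2(\mathbb D;K_\varphi)$ is regarded as a subspace of $H^2(\mathbb D^2)\cong H^2(\mathbb D;H^2)$ (with respect to the variable $z_1$): it consists of the functions $(z_1,z_2)\mapsto(\Psi(z_1)h(z_1))(z_2)$,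 $h\in H^2(\mathbb D;\mathcal E)$. Let $\sigma>0$ and $\theta\in[0,2\pi)$. The Brownian shift on $H^2\oplus\mathbb C$ and the $3$-Brownian shift on $H^2(\mathbb D^2)\oplus H^2\oplus\mathbb C$ are $$B_{\sigma,\theta}(f,\alpha)=(zf+\sigma\alpha,\ e^{i\theta}\alpha),\qquad T_{\sigma,\theta}(F,f,\alpha)=(z_1F+\sigma f_{z_2},\ zf+\sigma\alpha,\ e^{i\theta}\alpha).$$ Invariant subspaces are closed, and $\oplus$ denotes orthogonal direct sums. **Theorem.** Let $\mathcal M=\mathcal M_0\oplus\mathcal M_1$, with $\mathcal M_0\subseteq H^2(\mathbb D^2)$ and $\mathcal M_1\subseteq H^2\oplus\mathbb C$, be an invariant subspace of $T_{\sigma,\theta}$, where $\mathcal M_1$ is a nonzero invariant subspace of $B_{\sigma,\theta}$. Then $\mathcal M_1$ has the form in (1) or the form in (2) below, and: 1. If $\mathcal M_1=\varphi H^2\oplus\{0\}$ for an inner function $\varphi\in H^\infty(\mathbb D)$ (Type I), then there are a Hilbert space $\mathcal E$ and an operator-valued inner function $\Psi\in H^\infty(\mathbb D;\mathcal B(\mathcal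 E,K_\varphi))$ such that $$\mathcal M_0=\varphi_{z_2}H^2(\mathbb D^2)\oplus\Psi H^2(\mathbb D;\mathcal E).$$ 2. If $\mathcal M_1=\mathbb C\begin{bmatrix}g\\1\end{bmatrix}\oplus(\varphi H^2\oplus\{0\})$, where $\varphi\in H^\infty(\mathbb D)$ is an inner function whose radial limit $\varphi(e^{i\theta})$ exists and $g\in H^2$ is given by $$g(z)=\sigma\,\frac{\overline{\varphi(e^{i\theta})}\,\varphi(z)-1}{z-e^{i\theta}},\qquad z\in\mathbb D$$ (Type II), then $g\in K_\varphi$, and there are a Hilbert space $\mathcal E$ and an operator-valued inner function $\Psi\in H^\infty(\mathbb D;\mathcal B(\mathcal E,K_\varphi))$ such that $$\mathcal M_0=\varphi_{z_2}H^2(\mathbb D^2)\oplus g_{z_2}H^2_{z_1}\oplus\Psi H^2(\mathbb D;\mathcal E),\qquad \Psi(0)\mathcal E\subseteq g^\perp\subseteq K_\varphi .$$ -/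

import Mathlib

open scoped Topology ComplexConjugate

noncomputable section

/-- The open unit disc `𝔻`. -/
abbrev unitDisc : Set ℂ := Metric.ball (0 : ℂ) 1

/-- The Hardy space `H²(𝔻; E)`: the function `∑ aₙ zⁿ` is represented by its square-summable
sequence of Taylor coefficients, with the `ℓ²` inner product. -/
abbrev Hardy (E : Type*) [NormedAddCommGroup E] : Type _ := lp (fun _ : ℕ => E) 2

/-- The Hardy space `H²(𝔻²)` of the bidisc: the function `∑ aₘₙ z₁ᵐ z₂ⁿ` is represented by its
square-summable double sequence of Taylor coefficients, with the `ℓ²` inner product. -/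
abbrev HardyBidisc : Type := lp (fun _ : ℕ × ℕ => ℂ) 2

/-- The value at `z` of the function in `H²(𝔻; E)` with Taylor coefficients `f`. -/
def hardyEval {E : Type*} [NormedAddCommGroup E] [NormedSpace ℂ E] (f : Hardy E) (z : ℂ) : E :=
  ∑' n : ℕ, z ^ n • f n

/-- The value at `(z₁, z₂)` of the function in `H²(𝔻²)` with Taylor coefficients `F`. -/
def bidiscEval (F : HardyBidisc) (z₁ z₂ : ℂ) : ℂ :=
  ∑' p : ℕ × ℕ, z₁ ^ p.1 * z₂ ^ p.2 * F p

section Evaluation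

theorem hardyEval_summable {E : Type*} [NormedAddCommGroup E] [NormedSpace ℂ E] [CompleteSpace E]
    (f : Hardy E) {z : ℂ} (hz : z ∈ unitDisc) : Summable (fun n : ℕ => z ^ n • f n) := by
  have hz' : ‖z‖ < 1 := by simpa using hz
  refine Summable.of_norm_bounded (g := fun n : ℕ => ‖z‖ ^ n * ‖f‖)
    ((summable_geometric_of_lt_one (norm_nonneg _) hz').mul_right _) fun n => ?_
  rw [norm_smul, norm_pow]
  exact mul_le_mul_of_nonneg_left (lp.norm_apply_le_norm (by norm_num) f n) (by positivity)

theorem bidiscEval_summable (F : HardyBidisc) {z₁ z₂ : ℂ} (h₁ : z₁ ∈ unitDisc)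
    (h₂ : z₂ ∈ unitDisc) : Summable (fun p : ℕ × ℕ => z₁ ^ p.1 * z₂ ^ p.2 * F p) := by
  have h₁' : ‖z₁‖ < 1 := by simpa using h₁
  have h₂' : ‖z₂‖ < 1 := by simpa using h₂
  have hs := (summable_geometric_of_lt_one (norm_nonneg _) h₁').mul_of_nonneg
    (summable_geometric_of_lt_one (norm_nonneg _) h₂')
    (fun n => by positivity) (fun n => by positivity)
  refine Summable.of_norm_bounded (hs.mul_right ‖F‖) fun p => ?_
  rw [norm_mul, norm_mul, norm_pow, norm_pow]
  exact mul_le_mul_of_nonneg_left (lp.norm_apply_le_norm (by norm_num) F p) (by positivity)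

theorem hardyEval_zero {E : Type*} [NormedAddCommGroup E] [NormedSpace ℂ E] (z : ℂ) :
    hardyEval (0 : Hardy E) z = 0 := by
  simp [hardyEval]

theorem hardyEval_add {E : Type*} [NormedAddCommGroup E] [NormedSpace ℂ E] [CompleteSpace E]
    (f g : Hardy E) {z : ℂ} (hz : z ∈ unitDisc) :
    hardyEval (f + g) z = hardyEval f z + hardyEval g z := by
  simp only [hardyEval, lp.coeFn_add, Pi.add_apply, smul_add]
  exact (hardyEval_summable f hz).tsum_add (hardyEval_summable g hz)

theorem hardyEval_smul {E : Type*} [NormedAddCommGroup E] [NormedSpace ℂ E] [CompleteSpace E]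
    (c : ℂ) (f : Hardy E) {z : ℂ} (hz : z ∈ unitDisc) :
    hardyEval (c • f) z = c • hardyEval f z := by
  simp only [hardyEval, lp.coeFn_smul, Pi.smul_apply]
  rw [← (hardyEval_summable f hz).tsum_const_smul]
  exact tsum_congr fun n => smul_comm _ _ _

theorem bidiscEval_zero (z₁ z₂ : ℂ) : bidiscEval 0 z₁ z₂ = 0 := by
  simp [bidiscEval]

theorem bidiscEval_add (F G : HardyBidisc) {z₁ z₂ : ℂ} (h₁ : z₁ ∈ unitDisc) (h₂ : z₂ ∈ unitDisc) :
    bidiscEval (F + G) z₁ z₂ = bidiscEval F z₁ z₂ + bidiscEval G z₁ z₂ := by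
  simp only [bidiscEval, lp.coeFn_add, Pi.add_apply, mul_add]
  exact (bidiscEval_summable F h₁ h₂).tsum_add (bidiscEval_summable G h₁ h₂)

theorem bidiscEval_smul (c : ℂ) (F : HardyBidisc) (z₁ z₂ : ℂ) :
    bidiscEval (c • F) z₁ z₂ = c * bidiscEval F z₁ z₂ := by
  simp only [bidiscEval, lp.coeFn_smul, Pi.smul_apply, smul_eq_mul]
  rw [← tsum_mul_left]
  exact tsum_congr fun p => by ring

end Evaluation

/-! ### The Brownian shift and the 3-Brownian shift -/

/-- For an injective map `e` of index sets, the isometry of `ℓ²(ι; E)` into `ℓ²(κ; E)` that moves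
the `i`-th coefficient to the place `e i` and fills the other places with zeros. -/
def coeffPush {ι κ E : Type*} [NormedAddCommGroup E] [NormedSpace ℂ E] (e : ι → κ)
    (he : Function.Injective e) :
    lp (fun _ : ι => E) 2 →ₗᵢ[ℂ] lp (fun _ : κ => E) 2 where
  toFun f := ⟨Function.extend e f 0, by
    have h2 : (0 : ℝ) < (2 : ENNReal).toReal := by norm_num
    refine memℓp_gen ?_
    have h := (memℓp_gen_iff h2).1 (lp.memℓp f)
    rw [← summable_extend_zero he] at h
    refine h.congr fun k => ?_
    by_cases hk : ∃ i, e i = k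
    · obtain ⟨i, rfl⟩ := hk
      simp [he.extend_apply]
    · simp [Function.extend_apply' _ _ _ hk]⟩
  map_add' f g := by
    ext k
    change Function.extend e (⇑f + ⇑g) 0 k
      = Function.extend e (⇑f) 0 k + Function.extend e (⇑g) 0 k
    by_cases hk : ∃ i, e i = k
    · obtain ⟨i, rfl⟩ := hk
      simp [he.extend_apply]
    · simp [Function.extend_apply' _ _ _ hk]
  map_smul' c f := by
    ext k
    by_cases hk : ∃ i, e i = k
    · obtain ⟨i, rfl⟩ := hk
      simp [he.extend_apply]
    · simp [Function.extend_apply' _ _ _ hk]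
  norm_map' f := by
    have h2 : (0 : ℝ) < (2 : ENNReal).toReal := by norm_num
    rw [lp.norm_eq_tsum_rpow h2, lp.norm_eq_tsum_rpow h2, ← tsum_extend_zero he]
    congr 1
    refine tsum_congr fun k => ?_
    by_cases hk : ∃ i, e i = k
    · obtain ⟨i, rfl⟩ := hk
      simp [he.extend_apply]
    · simp [Function.extend_apply' _ _ _ hk]

/-- The unilateral shift `S` on `H²(𝔻)`, `(S f)(z) = z f(z)`. -/
def shiftS : Hardy ℂ →L[ℂ] Hardy ℂ :=
  (coeffPush Nat.succ Nat.succ_injective).toContinuousLinearMap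

/-- Multiplication by the first variable on `H²(𝔻²)`, `(M F)(z₁, z₂) = z₁ F(z₁, z₂)`. -/
def mulZ₁ : HardyBidisc →L[ℂ] HardyBidisc :=
  (coeffPush (fun p : ℕ × ℕ => (p.1 + 1, p.2)) (by
    rintro ⟨a, b⟩ ⟨c, d⟩ h; simpa using h)).toContinuousLinearMap

/-- The canonical embedding `J : H²(𝔻) → H²(𝔻²)`, `(J f)(z₁, z₂) = f(z₂)`. -/
def embedJ : Hardy ℂ →L[ℂ] HardyBidisc :=
  (coeffPush (fun n : ℕ => ((0 : ℕ), n)) (by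
    intro a b h; simpa using h)).toContinuousLinearMap

/-- The operator `1 ⊗ 1 : ℂ → H²(𝔻)` that sends a scalar to the constant function. -/
def constEmbed : ℂ →L[ℂ] Hardy ℂ := lp.singleContinuousLinearMap ℂ (fun _ : ℕ => ℂ) 2 0

section OperatorFormulas

theorem coeffPush_tsum {ι κ : Type*} (e : ι → κ) (he : Function.Injective e)
    (f : lp (fun _ : ι => ℂ) 2) (w : κ → ℂ) :
    ∑' k, w k * coeffPush e he f k = ∑' i, w (e i) * f i := by
  rw [← tsum_extend_zero he]
  refine tsum_congr fun k => ?_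
  change w k * Function.extend e f 0 k = _
  by_cases hk : ∃ i, e i = k
  · obtain ⟨i, rfl⟩ := hk
    simp [he.extend_apply]
  · simp [Function.extend_apply' _ _ _ hk]

theorem hardyEval_shiftS (f : Hardy ℂ) (z : ℂ) :
    hardyEval (shiftS f) z = z * hardyEval f z := by
  have h := coeffPush_tsum Nat.succ Nat.succ_injective f (fun n => z ^ n)
  simp only [hardyEval, smul_eq_mul]
  rw [← tsum_mul_left]
  exact h.trans (tsum_congr fun n => by rw [Nat.succ_eq_add_one]; ring)

theorem bidiscEval_mulZ₁ (F : HardyBidisc) (z₁ z₂ : ℂ) :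
    bidiscEval (mulZ₁ F) z₁ z₂ = z₁ * bidiscEval F z₁ z₂ := by
  have h := coeffPush_tsum (fun p : ℕ × ℕ => (p.1 + 1, p.2))
    (by rintro ⟨a, b⟩ ⟨c, d⟩ h; simpa using h) F (fun p => z₁ ^ p.1 * z₂ ^ p.2)
  simp only [bidiscEval]
  rw [← tsum_mul_left]
  exact h.trans (tsum_congr fun n => by ring)

theorem bidiscEval_embedJ (f : Hardy ℂ) (z₁ z₂ : ℂ) :
    bidiscEval (embedJ f) z₁ z₂ = hardyEval f z₂ := by
  have h := coeffPush_tsum (fun n : ℕ => ((0 : ℕ), n))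
    (by intro a b h; simpa using h) f (fun p => z₁ ^ p.1 * z₂ ^ p.2)
  simp only [bidiscEval, hardyEval, smul_eq_mul]
  exact h.trans (tsum_congr fun n => by simp)

theorem hardyEval_constEmbed (α z : ℂ) : hardyEval (constEmbed α) z = α := by
  simp only [hardyEval, smul_eq_mul]
  rw [tsum_eq_single 0]
  · simp [constEmbed]
  · intro n hn
    simp [constEmbed, hn]

end OperatorFormulas

/-- The Hilbert space `H²(𝔻) ⊕ ℂ`. -/
abbrev BrownianSpace : Type := WithLp 2 (Hardy ℂ × ℂ)

/-- The Hilbert space `H²(𝔻²) ⊕ (H²(𝔻) ⊕ ℂ)`. -/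
abbrev ThreeBrownianSpace : Type := WithLp 2 (HardyBidisc × BrownianSpace)

/-- The Brownian shift `(f, α) ↦ (S f + σ (1 ⊗ 1) α, e^{iθ} α)`. -/
def brownianShift (σ θ : ℝ) : BrownianSpace →L[ℂ] BrownianSpace :=
  (WithLp.prodContinuousLinearEquiv 2 ℂ (Hardy ℂ) ℂ).symm.toContinuousLinearMap ∘L
    ((shiftS ∘L WithLp.fstL 2 ℂ (Hardy ℂ) ℂ
        + (σ : ℂ) • (constEmbed ∘L WithLp.sndL 2 ℂ (Hardy ℂ) ℂ)).prod
      (Complex.exp (θ * Complex.I) • WithLp.sndL 2 ℂ (Hardy ℂ) ℂ))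

/-- The 3-Brownian shift
`(F, f, α) ↦ (z₁ F + σ J f, S f + σ (1 ⊗ 1) α, e^{iθ} α)`. -/
def threeBrownianShift (σ θ : ℝ) : ThreeBrownianSpace →L[ℂ] ThreeBrownianSpace :=
  (WithLp.prodContinuousLinearEquiv 2 ℂ HardyBidisc BrownianSpace).symm.toContinuousLinearMap ∘L
    ((mulZ₁ ∘L WithLp.fstL 2 ℂ HardyBidisc BrownianSpace
        + (σ : ℂ) • (embedJ ∘L WithLp.fstL 2 ℂ (Hardy ℂ) ℂ ∘L
            WithLp.sndL 2 ℂ HardyBidisc BrownianSpace)).prod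
      (brownianShift σ θ ∘L WithLp.sndL 2 ℂ HardyBidisc BrownianSpace))

theorem brownianShift_apply (σ θ : ℝ) (f : Hardy ℂ) (α : ℂ) :
    brownianShift σ θ (WithLp.toLp 2 (f, α)) =
      WithLp.toLp 2 (shiftS f + (σ : ℂ) • constEmbed α, Complex.exp (θ * Complex.I) * α) := rfl

theorem threeBrownianShift_apply (σ θ : ℝ) (F : HardyBidisc) (f : Hardy ℂ) (α : ℂ) :
    threeBrownianShift σ θ (WithLp.toLp 2 (F, WithLp.toLp 2 (f, α))) =
      WithLp.toLp 2 (mulZ₁ F + (σ : ℂ) • embedJ f,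
        WithLp.toLp 2 (shiftS f + (σ : ℂ) • constEmbed α,
          Complex.exp (θ * Complex.I) * α)) := rfl

/-- An invariant subspace of an operator is a closed subspace that the operator maps into
itself. -/
def IsInvariantSubspace {H : Type*} [NormedAddCommGroup H] [NormedSpace ℂ H] (T : H →L[ℂ] H)
    (M : Submodule ℂ H) : Prop :=
  IsClosed (M : Set H) ∧ ∀ x ∈ M, T x ∈ M

/-- The subspace `A ⊕ B = {(x, y) : x ∈ A, y ∈ B}` of the Hilbert space direct sum `H ⊕ K`. -/
def hilbertProd {H K : Type*} [NormedAddCommGroup H] [NormedSpace ℂ H] [NormedAddCommGroup K]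
    [NormedSpace ℂ K] (A : Submodule ℂ H) (B : Submodule ℂ K) : Submodule ℂ (WithLp 2 (H × K)) :=
  (A.prod B).comap (WithLp.linearEquiv 2 ℂ (H × K)).toLinearMap

/-! ### Inner functions and the subspaces they generate -/

/-- `Ψ` is an inner function: it belongs to `H^∞(𝔻; B(E, F))` and the multiplication operator
`M_Ψ : H²(𝔻; E) → H²(𝔻; F)` is an isometry. Only the values of `Ψ` on `𝔻` matter. -/
structure IsInnerFunction {E F : Type*} [NormedAddCommGroup E] [NormedSpace ℂ E]
    [NormedAddCommGroup F] [NormedSpace ℂ F] (Ψ : ℂ → E →L[ℂ] F) : Prop where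
  analytic : DifferentiableOn ℂ Ψ unitDisc
  bounded : ∃ C : ℝ, ∀ z ∈ unitDisc, ‖Ψ z‖ ≤ C
  isometry : ∀ f : Hardy E, ∃ g : Hardy F,
    (∀ z ∈ unitDisc, hardyEval g z = Ψ z (hardyEval f z)) ∧ ‖g‖ = ‖f‖

/-- A scalar inner function: the case `E = F = ℂ`, where `φ(z)` acts by multiplication. -/
def IsScalarInner (φ : ℂ → ℂ) : Prop :=
  IsInnerFunction (fun z => φ z • ContinuousLinearMap.id ℂ ℂ)

/-- The subspace `φ H²(𝔻)` of `H²(𝔻)`. -/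
def mulHardy (φ : ℂ → ℂ) : Submodule ℂ (Hardy ℂ) where
  carrier := {f | ∃ h : Hardy ℂ, ∀ z ∈ unitDisc, hardyEval f z = φ z * hardyEval h z}
  add_mem' := by
    rintro f₁ f₂ ⟨h₁, H₁⟩ ⟨h₂, H₂⟩
    refine ⟨h₁ + h₂, fun z hz => ?_⟩
    rw [hardyEval_add _ _ hz, hardyEval_add _ _ hz, H₁ z hz, H₂ z hz]
    ring
  zero_mem' := ⟨0, fun z _ => by simp [hardyEval_zero]⟩
  smul_mem' := by
    rintro c f ⟨h, H⟩
    refine ⟨c • h, fun z hz => ?_⟩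
    rw [hardyEval_smul _ _ hz, hardyEval_smul _ _ hz, H z hz]
    simp only [smul_eq_mul]
    ring

/-- The model space `K_φ = H²(𝔻) ⊖ φ H²(𝔻)`. -/
abbrev modelSpace (φ : ℂ → ℂ) : Submodule ℂ (Hardy ℂ) := (mulHardy φ)ᗮ

/-- The subspace `φ_{z₂} H²(𝔻²)` of `H²(𝔻²)`, where `φ_{z₂}(z₁, z₂) = φ(z₂)`. -/
def mulBidisc (φ : ℂ → ℂ) : Submodule ℂ HardyBidisc where
  carrier := {F | ∃ G : HardyBidisc, ∀ z₁ ∈ unitDisc, ∀ z₂ ∈ unitDisc,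
    bidiscEval F z₁ z₂ = φ z₂ * bidiscEval G z₁ z₂}
  add_mem' := by
    rintro f₁ f₂ ⟨h₁, H₁⟩ ⟨h₂, H₂⟩
    refine ⟨h₁ + h₂, fun z hz w hw => ?_⟩
    rw [bidiscEval_add _ _ hz hw, bidiscEval_add _ _ hz hw, H₁ z hz w hw, H₂ z hz w hw]
    ring
  zero_mem' := ⟨0, fun z _ w _ => by simp [bidiscEval_zero]⟩
  smul_mem' := by
    rintro c f ⟨h, H⟩
    refine ⟨c • h, fun z hz w hw => ?_⟩
    rw [bidiscEval_smul, bidiscEval_smul, H z hz w hw]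
    ring

/-- The subspace `g_{z₂} H²_{z₁}(𝔻)` of `H²(𝔻²)`: the functions `(z₁, z₂) ↦ g(z₂) h(z₁)` with
`h ∈ H²(𝔻)`. -/
def mulHardyZ₁ (g : Hardy ℂ) : Submodule ℂ HardyBidisc where
  carrier := {F | ∃ h : Hardy ℂ, ∀ z₁ ∈ unitDisc, ∀ z₂ ∈ unitDisc,
    bidiscEval F z₁ z₂ = hardyEval g z₂ * hardyEval h z₁}
  add_mem' := by
    rintro f₁ f₂ ⟨h₁, H₁⟩ ⟨h₂, H₂⟩
    refine ⟨h₁ + h₂, fun z hz w hw => ?_⟩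
    rw [bidiscEval_add _ _ hz hw, hardyEval_add _ _ hz, H₁ z hz w hw, H₂ z hz w hw]
    ring
  zero_mem' := ⟨0, fun z _ w _ => by simp [bidiscEval_zero, hardyEval_zero]⟩
  smul_mem' := by
    rintro c f ⟨h, H⟩
    refine ⟨c • h, fun z hz w hw => ?_⟩
    rw [bidiscEval_smul, hardyEval_smul _ _ hz, H z hz w hw]
    simp only [smul_eq_mul]
    ring

/-- The subspace `Ψ H²(𝔻; E)` of `H²(𝔻; K)`, for `K` a subspace of `H²(𝔻)`, seen inside
`H²(𝔻²)` by means of `H²(𝔻²) ≅ H²(𝔻; H²(𝔻))` with respect to the variable `z₁`: the functions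
`(z₁, z₂) ↦ (Ψ(z₁) h(z₁))(z₂)` with `h ∈ H²(𝔻; E)`. -/
def mulVector {E : Type*} [NormedAddCommGroup E] [NormedSpace ℂ E] [CompleteSpace E]
    {K : Submodule ℂ (Hardy ℂ)} (Ψ : ℂ → E →L[ℂ] K) : Submodule ℂ HardyBidisc where
  carrier := {F | ∃ h : Hardy E, ∀ z₁ ∈ unitDisc, ∀ z₂ ∈ unitDisc,
    bidiscEval F z₁ z₂ = hardyEval (Ψ z₁ (hardyEval h z₁) : Hardy ℂ) z₂}
  add_mem' := by
    rintro f₁ f₂ ⟨h₁, H₁⟩ ⟨h₂, H₂⟩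
    refine ⟨h₁ + h₂, fun z hz w hw => ?_⟩
    rw [bidiscEval_add _ _ hz hw, hardyEval_add _ _ hz, map_add, Submodule.coe_add,
      hardyEval_add _ _ hw, H₁ z hz w hw, H₂ z hz w hw]
  zero_mem' := ⟨0, fun z _ w _ => by simp [bidiscEval_zero, hardyEval_zero]⟩
  smul_mem' := by
    rintro c f ⟨h, H⟩
    refine ⟨c • h, fun z hz w hw => ?_⟩
    rw [bidiscEval_smul, hardyEval_smul _ _ hz, map_smul, Submodule.coe_smul,
      hardyEval_smul _ _ hw, H z hz w hw, smul_eq_mul]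

/-! ### Types of invariant subspaces of the Brownian shift -/

/-- The subspace `φ H²(𝔻) ⊕ {0}` of `H²(𝔻) ⊕ ℂ`. -/
def typeISubspace (φ : ℂ → ℂ) : Submodule ℂ BrownianSpace := hilbertProd (mulHardy φ) ⊥

/-- The subspace `ℂ (g, 1) ⊕ (φ H²(𝔻) ⊕ {0})` of `H²(𝔻) ⊕ ℂ`. -/
def typeIISubspace (φ : ℂ → ℂ) (g : Hardy ℂ) : Submodule ℂ BrownianSpace :=
  Submodule.span ℂ {WithLp.toLp 2 (g, (1 : ℂ))} ⊔ typeISubspace φ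

/-- The radial limit `φ(e^{iθ})` exists, and `g ∈ H²(𝔻)` is the function
`g(z) = σ (conj(φ(e^{iθ})) φ(z) - 1) / (z - e^{iθ})`. -/
def IsTypeIIPair (σ θ : ℝ) (φ : ℂ → ℂ) (g : Hardy ℂ) : Prop :=
  ∃ c : ℂ,
    Filter.Tendsto (fun r : ℝ => φ (r * Complex.exp (θ * Complex.I))) (𝓝[<] 1) (𝓝 c) ∧
    ∀ z ∈ unitDisc,
      hardyEval g z = σ * ((conj c * φ z - 1) / (z - Complex.exp (θ * Complex.I)))

end

set_option linter.unusedSectionVars false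

noncomputable section

/-! ### Power series with bounded coefficients -/

section PowerSeries

variable {X : Type*} [NormedAddCommGroup X] [NormedSpace ℂ X]

/-! The coupling `σ J` does most of the work. Applying the 3-Brownian shift to `(0, f, α)` with `(f,
α) ∈ M₁` puts `σ J f` in the first component, so `J f ∈ M₀`. Since `M₀` is closed and invariant
under `z₁`, it then contains every function whose coefficients in `z₁` lie in a subspace `A`, as
soon as it contains `J A` (`sliceSubspace_le`). Taking `A = φ H²` yields `φ_{z₂} H²(𝔻²)`. In Type II
the vector `(g, 1)` also permits `A = ℂ g`, which yields `g_{z₂} H²_{z₁}`.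

The orthogonal complement of such a slice space is the slice space of `Aᗮ`
(`orthogonal_sliceSubspace`), hence again `z₁`-invariant. What remains of `M₀` after removing these
pieces is therefore a closed `z₁`-invariant subspace of `H²(𝔻; K_φ)`, and the Beurling–Lax–Halmos
theorem writes it as `Ψ H²(𝔻; E)` (`exists_eq_mulVector`). Each `Ψ(0) e` is the zeroth slice of an
element of this remainder, so in Type II it is orthogonal to `g`.

Beurling–Lax–Halmos is derived from the Wold decomposition: an invariant `N` is the orthogonal sum
of the images under `Sⁿ` of its wandering subspace `N ⊖ S N`. For scalar functions the wandering
subspace is a line, which is Beurling's theorem.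

For the classification of `M₁`, let `N` be its part with zero scalar coordinate, and let `w =
e^{iθ}`. If `N` is not all of `M₁`, some `(g, 1) ∈ M₁` has `g ⟂ N`, and `S g + σ - w g` belongs to
`N = φ H²` and is orthogonal to every `φ zⁿ⁺¹`. It therefore equals `b φ`, with `|b| = σ` by
Pythagoras, and solving `(z - w) g = b φ - σ` gives the formula for `g` and the radial limit of `φ`.
-/

theorem hasFPowerSeriesOnBall_tsum_pow_smul [CompleteSpace X] (a : ℕ → X) (C : ℝ)
    (ha : ∀ n, ‖a n‖ ≤ C) :
    HasFPowerSeriesOnBall (fun z : ℂ => ∑' n : ℕ, z ^ n • a n)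
      (fun n => ContinuousMultilinearMap.mkPiRing ℂ (Fin n) (a n)) 0 1 where
  r_le := by
    have := FormalMultilinearSeries.le_radius_of_bound
      (fun n => ContinuousMultilinearMap.mkPiRing ℂ (Fin n) (a n)) C (r := 1) (fun n => by
        simpa using ha n)
    simpa using this
  r_pos := one_pos
  hasSum := by
    intro y hy
    have hy' : ‖y‖ < 1 := by
      have : y ∈ Metric.eball (0 : ℂ) (ENNReal.ofReal 1) := by simpa using hy
      rw [Metric.eball_ofReal] at this
      simpa using this
    have hs : Summable (fun n : ℕ => y ^ n • a n) := by
      refine Summable.of_norm_bounded (g := fun n : ℕ => ‖y‖ ^ n * C)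
        ((summable_geometric_of_lt_one (norm_nonneg _) hy').mul_right _) fun n => ?_
      rw [norm_smul, norm_pow]
      exact mul_le_mul_of_nonneg_left (ha n) (by positivity)
    simpa using hs.hasSum

theorem differentiableOn_tsum_pow_smul [CompleteSpace X] (a : ℕ → X) (C : ℝ)
    (ha : ∀ n, ‖a n‖ ≤ C) :
    DifferentiableOn ℂ (fun z : ℂ => ∑' n : ℕ, z ^ n • a n) unitDisc := by
  have h := (hasFPowerSeriesOnBall_tsum_pow_smul a C ha).differentiableOn
  have e : Metric.eball (0 : ℂ) 1 = unitDisc := by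
    rw [← ENNReal.ofReal_one, Metric.eball_ofReal]
  rwa [e] at h

/-- Uniqueness of power series at the origin. The subspaces and inner functions of the theorem are
described by values on the disc; this turns such pointwise identities into equalities of
coefficients. -/
theorem coeff_eq_of_tsum_pow_smul_eq [CompleteSpace X] {a b : ℕ → X} {C D : ℝ}
    (ha : ∀ n, ‖a n‖ ≤ C) (hb : ∀ n, ‖b n‖ ≤ D)
    (h : ∀ z ∈ unitDisc, ∑' n : ℕ, z ^ n • a n = ∑' n : ℕ, z ^ n • b n) : a = b := by
  have hA := (hasFPowerSeriesOnBall_tsum_pow_smul a C ha).hasFPowerSeriesAt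
  have hB := (hasFPowerSeriesOnBall_tsum_pow_smul b D hb).hasFPowerSeriesAt
  have hAB := HasFPowerSeriesAt.eq_formalMultilinearSeries_of_eventually hA hB
    (Filter.eventually_of_mem (Metric.ball_mem_nhds (0 : ℂ) one_pos) h)
  funext n
  have := congrArg (fun p : FormalMultilinearSeries ℂ ℂ X => p n (fun _ => 1)) hAB
  simpa using this

end PowerSeries

/-! ### Square-summable families -/

section SquareSummable

theorem memℓp_two_iff {ι : Type*} {E : ι → Type*} [∀ i, NormedAddCommGroup (E i)]
    {f : ∀ i, E i} : Memℓp f 2 ↔ Summable fun i => ‖f i‖ ^ 2 := by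
  simpa using memℓp_gen_iff (E := E) (f := f) (p := 2) (by norm_num)

theorem hasSum_norm_sq_lp {ι : Type*} {E : ι → Type*} [∀ i, NormedAddCommGroup (E i)]
    (f : lp E 2) : HasSum (fun i => ‖f i‖ ^ 2) (‖f‖ ^ 2) := by
  have h := lp.hasSum_norm (p := 2) (by norm_num) f
  simpa using h

theorem lp_norm_eq_of_norm_eq {ι κ : Type*} {E : ι → Type*} {F : κ → Type*}
    [∀ i, NormedAddCommGroup (E i)] [∀ i, NormedAddCommGroup (F i)] {f : lp E 2} {g : lp F 2}
    (h : HasSum (fun i => ‖f i‖ ^ 2) (‖g‖ ^ 2)) : ‖f‖ = ‖g‖ := by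
  have := (hasSum_norm_sq_lp f).unique h
  exact (sq_eq_sq₀ (norm_nonneg _) (norm_nonneg _)).1 this

end SquareSummable

/-! ### Point evaluations on the Hardy space -/

section Evaluation

variable {E : Type*} [NormedAddCommGroup E] [NormedSpace ℂ E]

theorem norm_sq_lt_one_of_mem_unitDisc {z : ℂ} (hz : z ∈ unitDisc) : ‖z‖ ^ 2 < 1 := by
  have hz' : ‖z‖ < 1 := by simpa using hz
  exact pow_lt_one₀ (norm_nonneg _) hz' two_ne_zero

theorem hardyEval_ext [CompleteSpace E] {f g : Hardy E}
    (h : ∀ z ∈ unitDisc, hardyEval f z = hardyEval g z) : f = g := by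
  ext1
  exact coeff_eq_of_tsum_pow_smul_eq (C := ‖f‖) (D := ‖g‖)
    (fun n => lp.norm_apply_le_norm (by norm_num) f n)
    (fun n => lp.norm_apply_le_norm (by norm_num) g n) h

theorem hardyEval_at_zero (f : Hardy E) : hardyEval f 0 = f 0 := by
  rw [hardyEval, tsum_eq_single 0 (fun n hn => by simp [hn])]
  simp

theorem hardyEval_single (n : ℕ) (e : E) (z : ℂ) :
    hardyEval (lp.single 2 n e : Hardy E) z = z ^ n • e := by
  rw [hardyEval, tsum_eq_single n (fun m hm => by simp [hm])]
  simp

/-- Cauchy–Schwarz on partial sums against the powers of `‖z‖`; `(1 - ‖z‖ ^ 2)⁻¹` is the squared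
norm of the Szegő kernel at `z`. -/
theorem norm_hardyEval_sq_le [CompleteSpace E] (f : Hardy E) {z : ℂ} (hz : z ∈ unitDisc) :
    ‖hardyEval f z‖ ^ 2 * (1 - ‖z‖ ^ 2) ≤ ‖f‖ ^ 2 := by
  have hz1 := norm_sq_lt_one_of_mem_unitDisc hz
  have hf := hasSum_norm_sq_lp f
  have hg := hasSum_geometric_of_lt_one (sq_nonneg ‖z‖) hz1
  have hsum : ‖hardyEval f z‖ ^ 2 ≤ ‖f‖ ^ 2 * (1 - ‖z‖ ^ 2)⁻¹ := by
    have hlim := ((hardyEval_summable f hz).hasSum.tendsto_sum_nat).norm.pow 2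
    refine le_of_tendsto' hlim fun N => ?_
    calc ‖∑ n ∈ Finset.range N, z ^ n • f n‖ ^ 2
        ≤ (∑ n ∈ Finset.range N, ‖f n‖ * ‖z‖ ^ n) ^ 2 := by
          gcongr
          refine (norm_sum_le _ _).trans_eq (Finset.sum_congr rfl fun n _ => ?_)
          rw [norm_smul, norm_pow, mul_comm]
      _ ≤ (∑ n ∈ Finset.range N, ‖f n‖ ^ 2) * ∑ n ∈ Finset.range N, (‖z‖ ^ n) ^ 2 :=
          Finset.sum_mul_sq_le_sq_mul_sq _ _ _
      _ ≤ ‖f‖ ^ 2 * (1 - ‖z‖ ^ 2)⁻¹ := by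
          gcongr
          · exact sum_le_hasSum _ (fun _ _ => by positivity) hf
          · refine (Finset.sum_congr rfl fun n _ => ?_).trans_le
              (sum_le_hasSum (Finset.range N) (fun _ _ => by positivity) hg)
            rw [← pow_mul, ← pow_mul, mul_comm]
  have hpos : 0 < 1 - ‖z‖ ^ 2 := by linarith
  calc _ ≤ ‖f‖ ^ 2 * (1 - ‖z‖ ^ 2)⁻¹ * (1 - ‖z‖ ^ 2) := by gcongr
    _ = ‖f‖ ^ 2 := by field_simp

/-- Multiples of the Szegő kernel realise vectors as values with the extremal norm. -/
theorem exists_hardyEval_eq_smul [CompleteSpace E] (e : E) {z : ℂ} (hz : z ∈ unitDisc) :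
    ∃ h : Hardy E, hardyEval h z = ((1 - ‖z‖ ^ 2 : ℝ) : ℂ)⁻¹ • e ∧
      ‖h‖ ^ 2 = (1 - ‖z‖ ^ 2)⁻¹ * ‖e‖ ^ 2 := by
  have hz1 := norm_sq_lt_one_of_mem_unitDisc hz
  have hg := (hasSum_geometric_of_lt_one (sq_nonneg ‖z‖) hz1)
  have hn : HasSum (fun n : ℕ => ‖(conj z) ^ n • e‖ ^ 2) ((1 - ‖z‖ ^ 2)⁻¹ * ‖e‖ ^ 2) := by
    refine (hg.mul_right (‖e‖ ^ 2)).congr_fun ?_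
    intro n
    rw [norm_smul, norm_pow, RCLike.norm_conj, mul_pow, ← pow_mul, ← pow_mul, mul_comm n]
  refine ⟨⟨fun n => (conj z) ^ n • e, memℓp_two_iff.2 hn.summable⟩, ?_, ?_⟩
  · have h2 := (Complex.hasSum_ofReal.2 hg).smul_const e
    rw [hardyEval, ← Complex.ofReal_inv, ← h2.tsum_eq]
    refine tsum_congr fun n => ?_
    simp only [smul_smul, ← mul_pow, Complex.mul_conj, Complex.normSq_eq_norm_sq]
    push_cast
    rfl
  · exact (hasSum_norm_sq_lp _).unique hn

end Evaluation

/-! ### The Wold decomposition of an invariant subspace of a pure isometry -/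

section Wold

variable {H G : Type*} [NormedAddCommGroup H] [InnerProductSpace ℂ H] [CompleteSpace H]
  [NormedAddCommGroup G] [InnerProductSpace ℂ G] [CompleteSpace G]

theorem mem_of_iterate_mem {S : H →ₗᵢ[ℂ] H} {N : Submodule ℂ H} (hN : ∀ x ∈ N, S x ∈ N) {x : H}
    (hx : x ∈ N) (n : ℕ) : (S ^ n) x ∈ N := by
  induction n with
  | zero => simpa using hx
  | succ n ih =>
    rw [pow_succ']
    exact hN _ ih

/-- Cancelling the smaller power of the isometry `S` leaves one vector in the wandering subspace,
which is orthogonal to `S N`, and another vector in `S N`. -/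
theorem orthogonalFamily_iterate_wandering (S : H →ₗᵢ[ℂ] H) (N : Submodule ℂ H)
    (hN : ∀ x ∈ N, S x ∈ N) (j : G →ₗᵢ[ℂ] H)
    (hj : ∀ a, j a ∈ N ⊓ (N.map S.toLinearMap)ᗮ) :
    OrthogonalFamily ℂ (fun _ : ℕ => G) (fun n => (S ^ n).comp j) := by
  have key : ∀ n k : ℕ, ∀ a b : G, inner ℂ ((S ^ n) (j a)) ((S ^ (n + k + 1)) (j b)) = 0 := by
    intro n k a b
    have e : (S ^ (n + k + 1)) (j b) = (S ^ n) (S ((S ^ k) (j b))) := by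
      rw [add_assoc, pow_add, pow_succ']
      rfl
    rw [e, LinearIsometry.inner_map_map]
    refine (Submodule.mem_orthogonal' _ _).1 (hj a).2 _ ?_
    exact Submodule.mem_map_of_mem (mem_of_iterate_mem hN (hj b).1 k)
  intro n m hnm a b
  rcases lt_or_gt_of_ne hnm with h | h
  · obtain ⟨k, rfl⟩ := Nat.exists_eq_add_of_lt h
    exact key n k a b
  · obtain ⟨k, rfl⟩ := Nat.exists_eq_add_of_lt h
    exact inner_eq_zero_symm.1 (key m k b a)

/-- Orthogonality of the pieces `Sⁿ (j G)` makes `V` isometric. Purity of `S`, the hypothesis `hS`,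
makes the pieces exhaust `N`. -/
theorem exists_wold_isometry (S : H →ₗᵢ[ℂ] H)
    (hS : ∀ x : H, (∀ n : ℕ, ∃ u, (S ^ n) u = x) → x = 0)
    (N : Submodule ℂ H) (hNc : IsClosed (N : Set H)) (hN : ∀ x ∈ N, S x ∈ N) (j : G →ₗᵢ[ℂ] H)
    (hj : LinearMap.range j.toLinearMap = N ⊓ (N.map S.toLinearMap)ᗮ) :
    ∃ V : Hardy G →ₗᵢ[ℂ] H, LinearMap.range V.toLinearMap = N ∧
      ∀ h : Hardy G, HasSum (fun n => (S ^ n) (j (h n))) (V h) := by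
  have hj' : ∀ a, j a ∈ N ⊓ (N.map S.toLinearMap)ᗮ := fun a => hj ▸ ⟨a, rfl⟩
  have hO := orthogonalFamily_iterate_wandering S N hN j hj'
  have hV : ∀ h : Hardy G, HasSum (fun n => (S ^ n) (j (h n))) (hO.linearIsometry h) :=
    fun h => hO.hasSum_linearIsometry h
  have hRN : LinearMap.range hO.linearIsometry.toLinearMap ≤ N := by
    rintro _ ⟨h, rfl⟩
    refine hNc.mem_of_tendsto (hV h).tendsto_sum_nat (Filter.Eventually.of_forall fun n => ?_)
    exact N.sum_mem fun i _ => mem_of_iterate_mem hN (hj' _).1 i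
  refine ⟨hO.linearIsometry, le_antisymm hRN ?_, hV⟩
  · have hRc : IsComplete (LinearMap.range hO.linearIsometry.toLinearMap : Set H) := by
      rw [LinearMap.coe_range]
      exact hO.linearIsometry.isometry.isUniformInducing.isComplete_range
    have hNcomp : CompleteSpace N := hNc.completeSpace_coe
    have hSN : IsComplete (N.map S.toLinearMap : Set H) := by
      have := (S.isometry.isUniformInducing.isComplete_iff (s := (N : Set H))).2 hNc.isComplete
      simpa using this
    have := hRc.completeSpace_coe
    have := hSN.completeSpace_coe
    have hjR : ∀ n a, (S ^ n) (j a) ∈ LinearMap.range hO.linearIsometry.toLinearMap := by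
      intro n a
      exact ⟨lp.single 2 n a, hO.linearIsometry_apply_single a⟩
    -- Split `N` into the range of `V` and its complement in `N`; a vector of the complement will
    -- turn out to lie in the range of every `Sⁿ`.
    rw [← Submodule.sup_orthogonal_inf_of_hasOrthogonalProjection hRN]
    suffices h0 : (LinearMap.range hO.linearIsometry.toLinearMap)ᗮ ⊓ N = ⊥ by
      rw [h0, sup_bot_eq]
    rw [eq_bot_iff]
    rintro y ⟨hy, hyN⟩
    refine hS y fun n => ?_
    -- Keeping the preimage `u` in `N` drives the induction: `y` is orthogonal to `Sⁿ` of the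
    -- wandering subspace, so the wandering part of `u` vanishes and `u ∈ S N`.
    suffices ∃ u ∈ N, (S ^ n) u = y from this.imp fun _ h => h.2
    induction n with
    | zero => exact ⟨y, hyN, rfl⟩
    | succ n ih =>
      obtain ⟨u, hu, hun⟩ := ih
      have hle : N.map S.toLinearMap ≤ N := by
        rintro _ ⟨x, hx, rfl⟩
        exact hN x hx
      have hu2 := hu
      rw [← Submodule.sup_orthogonal_inf_of_hasOrthogonalProjection hle] at hu2
      obtain ⟨s, hs, t, ht, hst⟩ := Submodule.mem_sup.1 hu2
      obtain ⟨v, hv, hvs⟩ := hs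
      obtain ⟨a, ha⟩ : t ∈ LinearMap.range j.toLinearMap := by
        rw [hj]
        exact ⟨ht.2, ht.1⟩
      have h1 : inner ℂ t u = 0 := by
        have := (Submodule.mem_orthogonal _ _).1 hy _ (hjR n a)
        rw [← hun, LinearIsometry.inner_map_map] at this
        rw [← ha]
        exact this
      have h2 : inner ℂ t s = 0 :=
        (Submodule.mem_orthogonal' _ _).1 ht.1 _ ⟨v, hv, hvs⟩
      have h3 : t = 0 := by
        rw [← hst, inner_add_right, h2, zero_add] at h1
        exact inner_self_eq_zero.1 h1
      refine ⟨v, hv, ?_⟩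
      rw [← hun, ← hst, h3, add_zero, ← hvs, pow_succ]
      rfl

end Wold

/-! ### The Beurling–Lax–Halmos theorem -/

section BeurlingLaxHalmos

variable {E F : Type*} [NormedAddCommGroup E] [InnerProductSpace ℂ E] [CompleteSpace E]
  [NormedAddCommGroup F] [InnerProductSpace ℂ F] [CompleteSpace F]

/-- The unilateral shift on `H²(𝔻; F)`. -/
def hardyShift (F : Type*) [NormedAddCommGroup F] [NormedSpace ℂ F] : Hardy F →ₗᵢ[ℂ] Hardy F :=
  coeffPush Nat.succ Nat.succ_injective

theorem coeffPush_apply {ι κ : Type*} (e : ι → κ) (he : Function.Injective e)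
    (f : lp (fun _ : ι => F) 2) (i : ι) : coeffPush e he f (e i) = f i := by
  change Function.extend e f 0 (e i) = _
  exact he.extend_apply _ _ _

theorem coeffPush_apply_of_notMem {ι κ : Type*} (e : ι → κ) (he : Function.Injective e)
    (f : lp (fun _ : ι => F) 2) (k : κ) (hk : ¬ ∃ i, e i = k) : coeffPush e he f k = 0 := by
  change Function.extend e f 0 k = _
  exact Function.extend_apply' _ _ _ hk

@[simp] theorem hardyShift_apply_succ (f : Hardy F) (n : ℕ) : hardyShift F f (n + 1) = f n :=
  coeffPush_apply Nat.succ Nat.succ_injective f n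

@[simp] theorem hardyShift_apply_zero (f : Hardy F) : hardyShift F f 0 = 0 :=
  coeffPush_apply_of_notMem Nat.succ Nat.succ_injective f 0 (by simp)

theorem hardyShift_single (n : ℕ) (a : F) :
    hardyShift F (lp.single 2 n a) = lp.single 2 (n + 1) a := by
  ext k
  cases k with
  | zero => simp
  | succ k => by_cases h : k = n <;> simp [h]

theorem hardyEval_hardyShift (f : Hardy F) {z : ℂ} (hz : z ∈ unitDisc) :
    hardyEval (hardyShift F f) z = z • hardyEval f z := by
  have h := hardyEval_summable (hardyShift F f) hz
  rw [hardyEval, h.tsum_eq_zero_add, hardyEval, ← (hardyEval_summable f hz).tsum_const_smul]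
  simp [pow_succ', mul_smul]

theorem hardyEval_hardyShift_pow (f : Hardy F) {z : ℂ} (hz : z ∈ unitDisc) (n : ℕ) :
    hardyEval ((hardyShift F ^ n) f) z = z ^ n • hardyEval f z := by
  induction n with
  | zero => simp
  | succ n ih =>
    rw [pow_succ', pow_succ', mul_smul, ← ih]
    exact hardyEval_hardyShift _ hz

theorem hardyShift_pow_apply_of_lt (f : Hardy F) {n k : ℕ} (hk : k < n) :
    (hardyShift F ^ n) f k = 0 := by
  induction n generalizing k with
  | zero => omega
  | succ n ih =>
    rw [pow_succ']
    change hardyShift F ((hardyShift F ^ n) f) k = 0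
    cases k with
    | zero => simp
    | succ k => simpa using ih (by omega)

/-- Purity of the shift: a `(k + 1)`-fold shift has vanishing `k`-th coefficient. -/
theorem eq_zero_of_mem_range_hardyShift_pow (f : Hardy F)
    (hf : ∀ n : ℕ, ∃ u, (hardyShift F ^ n) u = f) : f = 0 := by
  ext k
  obtain ⟨u, rfl⟩ := hf (k + 1)
  simpa using hardyShift_pow_apply_of_lt u (Nat.lt_succ_self k)

/-- The operator function `z ↦ (e ↦ (j e)(z))` of an isometry `j` into `H²(𝔻; F)`. -/
def symbol (j : E →ₗᵢ[ℂ] Hardy F) (z : ℂ) : E →L[ℂ] F :=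
  ∑' n : ℕ, z ^ n • (lp.evalCLM ℂ (fun _ : ℕ => F) 2 n ∘L j.toContinuousLinearMap)

theorem norm_evalCLM_comp_le (j : E →ₗᵢ[ℂ] Hardy F) (n : ℕ) :
    ‖lp.evalCLM ℂ (fun _ : ℕ => F) 2 n ∘L j.toContinuousLinearMap‖ ≤ 1 :=
  ContinuousLinearMap.opNorm_le_bound _ zero_le_one fun f => by
    rw [one_mul, ← j.norm_map f]
    exact lp.norm_apply_le_norm (by norm_num) (j f) n

theorem symbol_apply (j : E →ₗᵢ[ℂ] Hardy F) {z : ℂ} (hz : z ∈ unitDisc) (e : E) :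
    symbol j z e = hardyEval (j e) z := by
  have hz' : ‖z‖ < 1 := by simpa using hz
  have hs : Summable fun n : ℕ =>
      z ^ n • (lp.evalCLM ℂ (fun _ : ℕ => F) 2 n ∘L j.toContinuousLinearMap) := by
    refine Summable.of_norm_bounded (g := fun n : ℕ => ‖z‖ ^ n * 1)
      ((summable_geometric_of_lt_one (norm_nonneg _) hz').mul_right _) fun n => ?_
    rw [norm_smul, norm_pow]
    exact mul_le_mul_of_nonneg_left (norm_evalCLM_comp_le j n) (by positivity)
  have h := (hs.hasSum.mapL (ContinuousLinearMap.apply ℂ F e))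
  exact h.tsum_eq.symm

/-- An analytic operator function that multiplies isometrically is an inner function. -/
theorem IsInnerFunction.of_isometry {Ψ : ℂ → E →L[ℂ] F} (hΨ : DifferentiableOn ℂ Ψ unitDisc)
    (h : ∀ f : Hardy E, ∃ g : Hardy F,
      (∀ z ∈ unitDisc, hardyEval g z = Ψ z (hardyEval f z)) ∧ ‖g‖ = ‖f‖) :
    IsInnerFunction Ψ := by
  refine ⟨hΨ, ⟨1, fun z hz => ?_⟩, h⟩
  refine ContinuousLinearMap.opNorm_le_bound _ zero_le_one fun e => ?_
  -- Boundedness follows from isometry: on a multiple of the Szegő kernel the point evaluation bound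
  -- is sharp, and comparing the two sides gives `‖Ψ z e‖ ≤ ‖e‖`.
  obtain ⟨k, hk, hkn⟩ := exists_hardyEval_eq_smul e hz
  obtain ⟨g, hg, hgn⟩ := h k
  have hb := norm_hardyEval_sq_le g hz
  have hpos : 0 < 1 - ‖z‖ ^ 2 := by linarith [norm_sq_lt_one_of_mem_unitDisc hz]
  rw [hg z hz, hk, map_smul, norm_smul, hgn, hkn, norm_inv, Complex.norm_real, Real.norm_eq_abs,
    abs_of_pos hpos] at hb
  rw [one_mul]
  refine (sq_le_sq₀ (norm_nonneg _) (norm_nonneg _)).1 ?_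
  field_simp at hb
  exact hb

/-- Evaluation at `z` is the symbol of the identity isometry, hence a bounded operator. -/
theorem hasSum_hardyEval {ι : Type*} {f : ι → Hardy F} {g : Hardy F} (h : HasSum f g) {z : ℂ}
    (hz : z ∈ unitDisc) : HasSum (fun i => hardyEval (f i) z) (hardyEval g z) := by
  simpa only [symbol_apply _ hz, LinearIsometry.id_apply] using
    h.mapL (symbol (LinearIsometry.id (R := ℂ) (E := Hardy F)) z)

/-- The Beurling–Lax–Halmos theorem, with the wandering subspace parametrised by an isometry. -/
theorem exists_beurling_isometry (N : Submodule ℂ (Hardy F)) (hNc : IsClosed (N : Set (Hardy F)))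
    (hN : ∀ x ∈ N, hardyShift F x ∈ N) (j : E →ₗᵢ[ℂ] Hardy F)
    (hj : LinearMap.range j.toLinearMap = N ⊓ (N.map (hardyShift F).toLinearMap)ᗮ) :
    ∃ V : Hardy E →ₗᵢ[ℂ] Hardy F, LinearMap.range V.toLinearMap = N ∧
      ∀ h : Hardy E, ∀ z ∈ unitDisc, hardyEval (V h) z = symbol j z (hardyEval h z) := by
  obtain ⟨V, hVr, hV⟩ := exists_wold_isometry (hardyShift F)
    (fun x hx => eq_zero_of_mem_range_hardyShift_pow x hx) N hNc hN j hj
  refine ⟨V, hVr, fun h z hz => (hasSum_hardyEval (hV h) hz).unique ?_⟩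
  have h2 := (hardyEval_summable h hz).hasSum.mapL (symbol j z)
  refine h2.congr_fun fun n => ?_
  rw [hardyEval_hardyShift_pow _ hz, map_smul, symbol_apply j hz]

theorem isInnerFunction_symbol (j : E →ₗᵢ[ℂ] Hardy F) (V : Hardy E →ₗᵢ[ℂ] Hardy F)
    (hV : ∀ h : Hardy E, ∀ z ∈ unitDisc, hardyEval (V h) z = symbol j z (hardyEval h z)) :
    IsInnerFunction (symbol j) :=
  .of_isometry (differentiableOn_tsum_pow_smul _ 1 (norm_evalCLM_comp_le j))
    fun f => ⟨V f, hV f, V.norm_map f⟩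

/-- The Beurling–Lax–Halmos theorem. -/
theorem exists_isInnerFunction_range_eq {F : Type*} [NormedAddCommGroup F]
    [InnerProductSpace ℂ F] [CompleteSpace F] (N : Submodule ℂ (Hardy F))
    (hNc : IsClosed (N : Set (Hardy F))) (hN : ∀ x ∈ N, hardyShift F x ∈ N) :
    ∃ (W : Submodule ℂ (Hardy F)) (_ : CompleteSpace W) (Ψ : ℂ → W →L[ℂ] F)
      (V : Hardy W →ₗᵢ[ℂ] Hardy F), IsInnerFunction Ψ ∧ LinearMap.range V.toLinearMap = N ∧
      ∀ h : Hardy W, ∀ z ∈ unitDisc, hardyEval (V h) z = Ψ z (hardyEval h z) := by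
  set W : Submodule ℂ (Hardy F) := N ⊓ (N.map (hardyShift F).toLinearMap)ᗮ with hW
  have hWc : CompleteSpace W :=
    (hNc.inter (Submodule.isClosed_orthogonal _)).completeSpace_coe
  obtain ⟨V, hVr, hV⟩ := exists_beurling_isometry N hNc hN W.subtypeₗᵢ (by
    rw [← hW]
    exact W.range_subtype)
  exact ⟨W, hWc, symbol W.subtypeₗᵢ, V, isInnerFunction_symbol _ V hV, hVr, hV⟩

/-- Multiplication by an inner function, as an isometry of Hardy spaces. -/
theorem IsInnerFunction.exists_linearIsometry {Ψ : ℂ → E →L[ℂ] F} (hΨ : IsInnerFunction Ψ) :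
    ∃ V : Hardy E →ₗᵢ[ℂ] Hardy F,
      ∀ h : Hardy E, ∀ z ∈ unitDisc, hardyEval (V h) z = Ψ z (hardyEval h z) := by
  choose T hT hTn using hΨ.isometry
  refine ⟨{ toFun := T, map_add' := fun f g => ?_, map_smul' := fun c f => ?_, norm_map' := hTn },
    hT⟩
  · refine hardyEval_ext fun z hz => ?_
    simp only [hT _ z hz, hardyEval_add _ _ hz, map_add]
  · refine hardyEval_ext fun z hz => ?_
    simp only [hT _ z hz, hardyEval_smul _ _ hz, map_smul, RingHom.id_apply]

theorem hardyShift_comm_of_hardyEval {Ψ : ℂ → E →L[ℂ] F} {V : Hardy E →ₗᵢ[ℂ] Hardy F}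
    (hV : ∀ h : Hardy E, ∀ z ∈ unitDisc, hardyEval (V h) z = Ψ z (hardyEval h z)) (h : Hardy E) :
    V (hardyShift E h) = hardyShift F (V h) := by
  refine hardyEval_ext fun z hz => ?_
  rw [hV _ z hz, hardyEval_hardyShift _ hz, hardyEval_hardyShift _ hz, hV _ z hz, map_smul]

end BeurlingLaxHalmos

/-! ### Scalar inner functions and Beurling's theorem -/

section Scalar

/-- Multiplication by a scalar inner function, as an isometry of `H²(𝔻)` with range `φ H²(𝔻)`. -/
theorem IsScalarInner.exists_linearIsometry {φ : ℂ → ℂ} (hφ : IsScalarInner φ) :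
    ∃ V : Hardy ℂ →ₗᵢ[ℂ] Hardy ℂ,
      (∀ h : Hardy ℂ, ∀ z ∈ unitDisc, hardyEval (V h) z = φ z * hardyEval h z) ∧
      LinearMap.range V.toLinearMap = mulHardy φ ∧
      ∀ n : ℕ, ∀ a : ℂ, V (lp.single 2 (n + 1) a) = hardyShift ℂ (V (lp.single 2 n a)) := by
  obtain ⟨V, hV⟩ := IsInnerFunction.exists_linearIsometry hφ
  refine ⟨V, fun h z hz => by simpa using hV h z hz, ?_, fun n a => ?_⟩
  · ext f
    constructor
    · rintro ⟨h, rfl⟩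
      exact ⟨h, fun z hz => by simpa using hV h z hz⟩
    · rintro ⟨h, hh⟩
      exact ⟨h, hardyEval_ext fun z hz => by rw [hh z hz]; simpa using hV h z hz⟩
  · rw [← hardyShift_single, hardyShift_comm_of_hardyEval hV]

theorem isClosed_mulHardy {φ : ℂ → ℂ} (hφ : IsScalarInner φ) :
    IsClosed (mulHardy φ : Set (Hardy ℂ)) := by
  obtain ⟨V, -, hr, -⟩ := hφ.exists_linearIsometry
  rw [← hr, LinearMap.coe_range]
  exact V.isometry.isUniformInducing.isComplete_range.isClosed

/-- Beurling's theorem. -/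
theorem exists_eq_mulHardy (N : Submodule ℂ (Hardy ℂ)) (hNc : IsClosed (N : Set (Hardy ℂ)))
    (hN : ∀ x ∈ N, hardyShift ℂ x ∈ N) (hne : N ≠ ⊥) :
    ∃ φ : ℂ → ℂ, IsScalarInner φ ∧ N = mulHardy φ := by
  set W : Submodule ℂ (Hardy ℂ) := N ⊓ (N.map (hardyShift ℂ).toLinearMap)ᗮ with hW
  have hWc : CompleteSpace W :=
    (hNc.inter (Submodule.isClosed_orthogonal _)).completeSpace_coe
  obtain ⟨V, hVr, hV⟩ := exists_beurling_isometry N hNc hN W.subtypeₗᵢ (by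
    rw [← hW]
    exact W.range_subtype)
  have hWne : W ≠ ⊥ := by
    intro h0
    refine hne ((eq_bot_iff).2 ?_)
    rw [← hVr]
    rintro _ ⟨h, rfl⟩
    have : h = 0 := by
      ext n
      have h1 : ((h n : W) : Hardy ℂ) ∈ (⊥ : Submodule ℂ (Hardy ℂ)) := by
        rw [← h0]
        exact (h n).2
      have h2 : ((h n : W) : Hardy ℂ) = 0 := h1
      rw [h2]
      rfl
    rw [this]
    exact map_zero _
  obtain ⟨e₀, he₀W, he₀⟩ := Submodule.exists_mem_ne_zero_of_ne_bot hWne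
  obtain ⟨e, heW, he1⟩ : ∃ e ∈ W, ‖e‖ = 1 :=
    ⟨((‖e₀‖ : ℂ)⁻¹) • e₀, W.smul_mem _ he₀W, by simpa using norm_smul_inv_norm (𝕜 := ℂ) he₀⟩
  -- These coefficients represent the function `z ↦ f(z) x` in `H²(𝔻; W)`.
  have hmem : ∀ (f : Hardy ℂ) (x : W), Memℓp (fun n => f n • x) 2 := by
    intro f x
    rw [memℓp_two_iff]
    simpa [norm_smul, mul_pow] using (hasSum_norm_sq_lp f).summable.mul_right (‖x‖ ^ 2)
  have heval : ∀ (f : Hardy ℂ) (x : W) (z : ℂ), z ∈ unitDisc →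
      hardyEval (⟨_, hmem f x⟩ : Hardy W) z = hardyEval f z • x := by
    intro f x z hz
    have := (hardyEval_summable f hz).hasSum.smul_const x
    exact (tsum_congr fun n => (smul_assoc _ _ _).symm).trans this.tsum_eq
  -- The wandering subspace is a line by commutativity: `V` sends both `x(z) ⊗ e` and `e(z) ⊗ x` to
  -- the product `x(z) e(z)`, so injectivity of `V` makes the two equal. A nonzero coefficient of
  -- `e` then exhibits `x` as a multiple of `e`.
  have hspan : W ≤ ℂ ∙ e := by
    intro x hx
    have hVV : V ⟨_, hmem x ⟨e, heW⟩⟩ = V ⟨_, hmem e ⟨x, hx⟩⟩ := by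
      refine hardyEval_ext fun z hz => ?_
      rw [hV _ z hz, hV _ z hz, heval _ _ z hz, heval _ _ z hz, map_smul, map_smul,
        symbol_apply _ hz, symbol_apply _ hz]
      simp [mul_comm]
    have hh := V.injective hVV
    obtain ⟨n, hn⟩ : ∃ n, e n ≠ 0 := by
      by_contra! h0
      have : e = 0 := by
        ext n
        exact h0 n
      simp [this] at he1
    have h3 : x n • e = e n • x := by
      have h4 : x n • (⟨e, heW⟩ : W) = e n • (⟨x, hx⟩ : W) :=
        congrFun (congrArg (fun h : Hardy W => (h : ℕ → W)) hh) n
      exact congrArg Subtype.val h4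
    refine Submodule.mem_span_singleton.2 ⟨(e n)⁻¹ * x n, ?_⟩
    rw [mul_smul, h3, smul_smul, inv_mul_cancel₀ hn, one_smul]
  have hj : LinearMap.range (LinearIsometry.toSpanSingleton ℂ (Hardy ℂ) he1).toLinearMap = W := by
    refine le_antisymm ?_ fun x hx => ?_
    · rintro _ ⟨a, rfl⟩
      exact W.smul_mem _ heW
    · obtain ⟨a, ha⟩ := Submodule.mem_span_singleton.1 (hspan hx)
      exact ⟨a, ha⟩
  -- Parametrising the wandering line by `ℂ` through the unit vector `e` makes the symbol scalar;
  -- its value at `1` is `e(z)`, which serves as `φ`.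
  obtain ⟨U, hUr, hU⟩ := exists_beurling_isometry N hNc hN _ hj
  set Ψ := symbol (LinearIsometry.toSpanSingleton ℂ (Hardy ℂ) he1) with hΨ
  have hΨ1 : (fun z => Ψ z 1 • ContinuousLinearMap.id ℂ ℂ) = Ψ := by
    funext z
    ext
    simp
  have hinner : IsScalarInner (fun z => Ψ z 1) := by
    rw [IsScalarInner, hΨ1]
    exact isInnerFunction_symbol _ U hU
  refine ⟨fun z => Ψ z 1, hinner, ?_⟩
  have hmul : ∀ (z a : ℂ), Ψ z a = Ψ z 1 * a := fun z a => by
    conv_lhs => rw [← hΨ1]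
    simp
  rw [← hUr]
  ext f
  constructor
  · rintro ⟨h, rfl⟩
    exact ⟨h, fun z hz => by rw [← hmul]; exact hU h z hz⟩
  · rintro ⟨h, hh⟩
    exact ⟨h, hardyEval_ext fun z hz => by rw [hh z hz, ← hmul]; exact hU h z hz⟩

end Scalar

/-! ### Invariant subspaces of the Brownian shift -/

section Brownian

theorem exp_mul_I_norm (θ : ℝ) : ‖Complex.exp (θ * Complex.I)‖ = 1 :=
  Complex.norm_exp_ofReal_mul_I θ

/-- The radial growth of a function in `H²(𝔻)` is of lower order than `(1 - r)⁻¹`. -/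
theorem tendsto_one_sub_mul_hardyEval (g : Hardy ℂ) {w : ℂ} (hw : ‖w‖ = 1) :
    Filter.Tendsto (fun r : ℝ => ((1 - r : ℝ) : ℂ) * hardyEval g (r * w)) (𝓝[<] 1) (𝓝 0) := by
  -- The majorant comes from the point evaluation bound at `r w` together with `1 - r ≤ 1 - r ^ 2`.
  have hlim : Filter.Tendsto (fun r : ℝ => Real.sqrt ((1 - r) * ‖g‖ ^ 2)) (𝓝[<] 1) (𝓝 0) := by
    have : Continuous fun r : ℝ => Real.sqrt ((1 - r) * ‖g‖ ^ 2) := by fun_prop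
    have h := this.tendsto 1
    simp only [sub_self, zero_mul, Real.sqrt_zero] at h
    exact h.mono_left nhdsWithin_le_nhds
  refine squeeze_zero_norm' ?_ hlim
  filter_upwards [Ioo_mem_nhdsLT (zero_lt_one (α := ℝ))] with r hr
  have hn : ‖(r : ℂ) * w‖ = r := by simp [hw, abs_of_pos hr.1]
  have hz : (r : ℂ) * w ∈ unitDisc := by simp [hw, abs_of_pos hr.1, hr.2]
  have hb := norm_hardyEval_sq_le g hz
  rw [hn] at hb
  refine Real.le_sqrt_of_sq_le ?_
  rw [norm_mul, Complex.norm_real, Real.norm_eq_abs, abs_of_pos (by linarith [hr.2]), mul_pow]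
  have h1 : 0 ≤ ‖hardyEval g (r * w)‖ ^ 2 := sq_nonneg _
  have h2 : 0 < 1 - r := by linarith [hr.2]
  have h3 : (1 - r) * ‖hardyEval g (r * w)‖ ^ 2 ≤ ‖hardyEval g (r * w)‖ ^ 2 * (1 - r ^ 2) := by
    have : 1 - r ≤ 1 - r ^ 2 := by nlinarith [hr.1]
    nlinarith
  calc (1 - r) ^ 2 * ‖hardyEval g (r * w)‖ ^ 2
      = (1 - r) * ((1 - r) * ‖hardyEval g (r * w)‖ ^ 2) := by ring
    _ ≤ (1 - r) * ‖g‖ ^ 2 := by gcongr; linarith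

theorem constEmbed_eq (a : ℂ) : constEmbed a = lp.single 2 0 a := rfl

theorem inner_hardyShift_constEmbed (f : Hardy ℂ) (a : ℂ) :
    inner ℂ (hardyShift ℂ f) (constEmbed a) = 0 := by
  rw [constEmbed_eq, lp.inner_single_right]
  simp

theorem norm_hardyShift_add_constEmbed (f : Hardy ℂ) (a : ℂ) :
    ‖hardyShift ℂ f + constEmbed a‖ ^ 2 = ‖f‖ ^ 2 + ‖a‖ ^ 2 := by
  rw [sq, norm_add_sq_eq_norm_sq_add_norm_sq_of_inner_eq_zero _ _
    (inner_hardyShift_constEmbed f a), LinearIsometry.norm_map, constEmbed_eq,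
    lp.norm_single (by norm_num), sq, sq]

/-- For a Type II pair, `g` is orthogonal to `φ H²(𝔻)`. -/
theorem IsTypeIIPair.mem_modelSpace {σ θ : ℝ} {φ : ℂ → ℂ} {g : Hardy ℂ} (hφ : IsScalarInner φ)
    (h : IsTypeIIPair σ θ φ g) : g ∈ modelSpace φ := by
  obtain ⟨c, -, hc⟩ := h
  obtain ⟨V, hV, hr, hVS⟩ := hφ.exists_linearIsometry
  set w := Complex.exp (θ * Complex.I) with hw
  have hwn : ‖w‖ = 1 := exp_mul_I_norm θ
  -- The formula for `g` with its denominator cleared: `(z - w) g + σ = σ c̄ φ`.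
  have hrel : hardyShift ℂ g + constEmbed σ - w • g = V (lp.single 2 0 (σ * conj c)) := by
    refine hardyEval_ext fun z hz => ?_
    have hzw : z - w ≠ 0 := by
      intro h0
      rw [sub_eq_zero.1 h0] at hz
      simp [hwn] at hz
    rw [sub_eq_add_neg, ← neg_smul, hardyEval_add _ _ hz, hardyEval_add _ _ hz,
      hardyEval_smul _ _ hz, hardyEval_hardyShift _ hz, hardyEval_constEmbed, hV _ z hz,
      hardyEval_single, hc z hz]
    simp only [smul_eq_mul]
    field_simp
    ring
  have hcoef : ∀ n, ContinuousLinearMap.adjoint V.toContinuousLinearMap g n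
      = inner ℂ (V (lp.single 2 n 1)) g := by
    intro n
    have := ContinuousLinearMap.adjoint_inner_right V.toContinuousLinearMap
      (lp.single 2 n (1 : ℂ)) g
    rw [lp.inner_single_left] at this
    simpa using this
  set y := ContinuousLinearMap.adjoint V.toContinuousLinearMap g with hy
  -- Pair `hrel` with `φ zⁿ⁺¹`, which is orthogonal to the multiples of `φ`. The coefficients `y n =
  -- ⟨φ zⁿ, g⟩` thus have constant modulus, and square-summability forces them to vanish.
  have hstep : ∀ n, y n = w * y (n + 1) := by
    intro n
    have h1 : inner ℂ (V (lp.single 2 (n + 1) 1)) (V (lp.single 2 0 (σ * conj c))) = 0 := by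
      rw [V.inner_map_map, lp.inner_single_left]
      simp
    rw [← hrel, inner_sub_right, inner_add_right, inner_smul_right, ← hcoef, hVS,
      inner_hardyShift_constEmbed, LinearIsometry.inner_map_map, ← hcoef, add_zero] at h1
    exact sub_eq_zero.1 h1
  have hconst : ∀ n, ‖y n‖ = ‖y 0‖ := by
    intro n
    induction n with
    | zero => rfl
    | succ n ih => rw [← ih, hstep n, norm_mul, hwn, one_mul]
  have hy0 : y = 0 := by
    have hlim := (hasSum_norm_sq_lp y).summable.tendsto_atTop_zero
    simp only [hconst] at hlim
    have h0 := tendsto_nhds_unique hlim tendsto_const_nhds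
    ext n
    have : ‖y n‖ = 0 := by
      rw [hconst]
      simpa using h0.symm
    simpa using this
  rw [modelSpace, ← hr, Submodule.mem_orthogonal]
  rintro _ ⟨u, rfl⟩
  have := ContinuousLinearMap.adjoint_inner_right V.toContinuousLinearMap u g
  rw [← hy, hy0, inner_zero_right] at this
  exact this.symm

/-- The classification of the nonzero invariant subspaces of the Brownian shift. -/
theorem brownianShift_invariant_classification {σ θ : ℝ} (hσ : 0 < σ)
    {M : Submodule ℂ BrownianSpace} (hM : IsInvariantSubspace (brownianShift σ θ) M)
    (hne : M ≠ ⊥) :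
    (∃ φ : ℂ → ℂ, IsScalarInner φ ∧ M = typeISubspace φ) ∨
      (∃ (φ : ℂ → ℂ) (g : Hardy ℂ),
        IsScalarInner φ ∧ IsTypeIIPair σ θ φ g ∧ M = typeIISubspace φ g) := by
  obtain ⟨hMc, hMB⟩ := hM
  set w := Complex.exp (θ * Complex.I) with hw
  have hwn : ‖w‖ = 1 := exp_mul_I_norm θ
  let ι : Hardy ℂ →L[ℂ] BrownianSpace :=
    (WithLp.prodContinuousLinearEquiv 2 ℂ (Hardy ℂ) ℂ).symm.toContinuousLinearMap ∘L
      ContinuousLinearMap.inl ℂ (Hardy ℂ) ℂ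
  have hι : ∀ f, ι f = WithLp.toLp 2 (f, 0) := fun f => rfl
  set N : Submodule ℂ (Hardy ℂ) := M.comap ι.toLinearMap with hNdef
  have hNmem : ∀ f, f ∈ N ↔ WithLp.toLp 2 (f, (0 : ℂ)) ∈ M := fun f => Iff.rfl
  have hNc : IsClosed (N : Set (Hardy ℂ)) := hMc.preimage ι.continuous
  have hNS : ∀ f ∈ N, hardyShift ℂ f ∈ N := by
    intro f hf
    have := hMB _ ((hNmem f).1 hf)
    rw [brownianShift_apply, map_zero, smul_zero, add_zero, mul_zero] at this
    exact this
  by_cases hA : ∀ x ∈ M, x.snd = 0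
  · left
    have hMN : M = hilbertProd N ⊥ := by
      ext x
      constructor
      · intro hx
        have h0 := hA x hx
        have hx' : x = WithLp.toLp 2 (x.fst, (0 : ℂ)) := by
          rw [← h0]
          rfl
        refine ⟨?_, h0⟩
        change x.fst ∈ N
        rw [hNmem, ← hx']
        exact hx
      · rintro ⟨h1, h2⟩
        have hx' : x = WithLp.toLp 2 (x.fst, (0 : ℂ)) := by
          have h2' : x.snd = 0 := h2
          rw [← h2']
          rfl
        rw [hx']
        exact (hNmem _).1 h1
    have hNne : N ≠ ⊥ := by
      intro h0
      refine hne ((Submodule.eq_bot_iff _).2 fun x hx => ?_)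
      rw [hMN] at hx
      obtain ⟨h1, h2⟩ := hx
      have h1' : x.fst = 0 := by
        have : x.fst ∈ N := h1
        rwa [h0] at this
      have h2' : x.snd = 0 := h2
      exact (WithLp.ofLp_injective 2) (Prod.ext h1' h2')
    obtain ⟨φ, hφ, hNφ⟩ := exists_eq_mulHardy N hNc hNS hNne
    exact ⟨φ, hφ, by rw [hMN, hNφ, typeISubspace]⟩
  · right
    push Not at hA
    obtain ⟨x, hxM, hx0⟩ := hA
    have hNcs : CompleteSpace N := hNc.completeSpace_coe
    obtain ⟨g, hgM, hgN⟩ : ∃ g : Hardy ℂ, WithLp.toLp 2 (g, (1 : ℂ)) ∈ M ∧ g ∈ Nᗮ := by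
      set f := (x.snd)⁻¹ • x.fst with hf
      have hfM : WithLp.toLp 2 (f, (1 : ℂ)) ∈ M := by
        have := M.smul_mem (x.snd)⁻¹ hxM
        have e : (x.snd)⁻¹ • x = WithLp.toLp 2 (f, (1 : ℂ)) :=
          (WithLp.ofLp_injective 2) (Prod.ext rfl (inv_mul_cancel₀ hx0))
        rwa [e] at this
      have hfN : f ∈ N ⊔ Nᗮ := by
        rw [Submodule.sup_orthogonal_of_hasOrthogonalProjection]
        trivial
      obtain ⟨p, hp, g, hg, hpg⟩ := Submodule.mem_sup.1 hfN
      refine ⟨g, ?_, hg⟩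
      have := M.sub_mem hfM ((hNmem p).1 hp)
      have e : WithLp.toLp 2 (f, (1 : ℂ)) - WithLp.toLp 2 (p, (0 : ℂ))
          = WithLp.toLp 2 (g, (1 : ℂ)) := by
        refine (WithLp.ofLp_injective 2) (Prod.ext ?_ ?_)
        · change f - p = g
          rw [← hpg]
          simp
        · exact sub_zero _
      rwa [e] at this
    -- This is the first component of `(B - w)(g, 1)`, whose scalar component is zero.
    set q : Hardy ℂ := hardyShift ℂ g + constEmbed σ - w • g with hq
    have hqN : q ∈ N := by
      rw [hNmem]
      have := M.sub_mem (hMB _ hgM) (M.smul_mem w hgM)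
      rw [brownianShift_apply] at this
      have e : WithLp.toLp 2 (shiftS g + (σ : ℂ) • constEmbed 1,
          Complex.exp (θ * Complex.I) * 1) - w • WithLp.toLp 2 (g, (1 : ℂ))
          = WithLp.toLp 2 (q, (0 : ℂ)) := by
        refine (WithLp.ofLp_injective 2) (Prod.ext ?_ ?_)
        · change shiftS g + (σ : ℂ) • constEmbed 1 - w • g = q
          rw [← map_smul, smul_eq_mul, mul_one]
          rfl
        · exact sub_self _
      rwa [e] at this
    have hgq : inner ℂ (w • g) q = 0 := by
      rw [inner_smul_left, (Submodule.mem_orthogonal' _ _).1 hgN q hqN, mul_zero]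
    -- Pythagoras twice: `S g + σ` has squared norm `‖g‖² + σ²`, and it is also the orthogonal sum
    -- of `w g` and `q`.
    have hqn : ‖q‖ ^ 2 = σ ^ 2 := by
      have h1 : hardyShift ℂ g + constEmbed σ = w • g + q := by
        rw [hq]
        abel
      have h2 := norm_hardyShift_add_constEmbed g σ
      have h3 := norm_add_sq_eq_norm_sq_add_norm_sq_of_inner_eq_zero _ _ hgq
      rw [h1, sq, h3, norm_smul, hwn, Complex.norm_real, Real.norm_eq_abs, sq_abs] at h2
      nlinarith
    have hNne : N ≠ ⊥ := by
      intro h0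
      rw [h0, Submodule.mem_bot] at hqN
      rw [hqN, norm_zero] at hqn
      nlinarith
    obtain ⟨φ, hφ, hNφ⟩ := exists_eq_mulHardy N hNc hNS hNne
    obtain ⟨V, hV, hr, hVS⟩ := hφ.exists_linearIsometry
    have hVN : ∀ h, V h ∈ N := fun h => by
      rw [hNφ, ← hr]
      exact ⟨h, rfl⟩
    obtain ⟨k, hk⟩ : q ∈ LinearMap.range V.toLinearMap := by rwa [hr, ← hNφ]
    have hk' : V k = q := hk
    -- `q` is orthogonal to `φ zⁿ⁺¹ = S (φ zⁿ)`: the term `S g` reduces to `⟨φ zⁿ, g⟩ = 0`,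
    -- constants are orthogonal to the range of `S`, and `g ⟂ N`. So `k` is a constant `b`, and `q =
    -- b φ`.
    have hkn : ∀ n, k (n + 1) = 0 := by
      intro n
      have h1 : inner ℂ (V (lp.single 2 (n + 1) 1)) (V k) = k (n + 1) := by
        rw [V.inner_map_map, lp.inner_single_left]
        simp
      have h2 : ∀ m, inner ℂ (V (lp.single 2 m 1)) g = 0 := fun m =>
        (Submodule.mem_orthogonal _ _).1 hgN _ (hVN _)
      rw [← h1, hk', hq, inner_sub_right, inner_add_right, inner_smul_right, h2, hVS,
        inner_hardyShift_constEmbed, LinearIsometry.inner_map_map, h2]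
      simp
    have hk0 : k = lp.single 2 0 (k 0) := by
      ext n
      cases n with
      | zero => simp
      | succ n => simp [hkn]
    set b := k 0 with hb
    have hbn : ‖b‖ ^ 2 = σ ^ 2 := by
      rw [← hqn, ← hk', V.norm_map, hk0, lp.norm_single (by norm_num)]
    have hb0 : b ≠ 0 := by
      intro h0
      rw [h0, norm_zero] at hbn
      nlinarith
    have hrel : ∀ z ∈ unitDisc, (z - w) * hardyEval g z = b * φ z - σ := by
      intro z hz
      have h1 : hardyEval (V k) z = φ z * b := by
        rw [hV k z hz, hk0, hardyEval_single]
        simp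
      rw [hk', hq, sub_eq_add_neg, ← neg_smul, hardyEval_add _ _ hz, hardyEval_add _ _ hz,
        hardyEval_smul _ _ hz, hardyEval_hardyShift _ hz, hardyEval_constEmbed] at h1
      simp only [smul_eq_mul] at h1
      linear_combination h1
    have hσ0 : (σ : ℂ) ≠ 0 := by exact_mod_cast hσ.ne'
    have hbb : b * conj b = (σ : ℂ) ^ 2 := by
      rw [Complex.mul_conj, Complex.normSq_eq_norm_sq, hbn]
      push_cast
      rfl
    -- On the radius, `b φ(r w) = σ - w (1 - r) g(r w)`, whose last term tends to zero; hence the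
    -- limit `σ / b`. Its conjugate is `b / σ` because `|b| = σ`.
    refine ⟨φ, g, hφ, ⟨σ / b, ?_, fun z hz => ?_⟩, ?_⟩
    · have hlim := tendsto_one_sub_mul_hardyEval g hwn
      have hlim2 : Filter.Tendsto (fun r : ℝ =>
          (σ - w * (((1 - r : ℝ) : ℂ) * hardyEval g (r * w))) / b) (𝓝[<] 1) (𝓝 (σ / b)) := by
        simpa using ((hlim.const_mul w).const_sub (σ : ℂ)).div_const b
      refine hlim2.congr' ?_
      filter_upwards [Ioo_mem_nhdsLT (zero_lt_one (α := ℝ))] with r hr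
      have hz : (r : ℂ) * w ∈ unitDisc := by simp [hwn, abs_of_pos hr.1, hr.2]
      have := hrel _ hz
      rw [div_eq_iff hb0]
      push_cast
      linear_combination this
    · have hzw : z - w ≠ 0 := by
        intro h0
        rw [sub_eq_zero.1 h0] at hz
        simp [hwn] at hz
      have hcb : conj b ≠ 0 := by simpa using hb0
      have h1 : conj (σ / b : ℂ) = b / σ := by
        rw [map_div₀, Complex.conj_ofReal, div_eq_div_iff hcb hσ0, hbb, sq]
      rw [h1, ← mul_div_assoc, eq_div_iff hzw, mul_comm, hrel z hz]
      field_simp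
    · refine le_antisymm (fun y hy => ?_) ?_
      · rw [typeIISubspace, Submodule.mem_sup]
        refine ⟨y.snd • WithLp.toLp 2 (g, (1 : ℂ)),
          Submodule.smul_mem _ _ (Submodule.mem_span_singleton_self _),
          WithLp.toLp 2 (y.fst - y.snd • g, (0 : ℂ)), ⟨?_, rfl⟩, ?_⟩
        · change y.fst - y.snd • g ∈ mulHardy φ
          rw [← hNφ, hNmem]
          have := M.sub_mem hy (M.smul_mem y.snd hgM)
          have e : y - y.snd • WithLp.toLp 2 (g, (1 : ℂ))
              = WithLp.toLp 2 (y.fst - y.snd • g, (0 : ℂ)) := by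
            refine (WithLp.ofLp_injective 2) (Prod.ext rfl ?_)
            change y.snd - y.snd * 1 = 0
            simp
          rwa [e] at this
        · refine (WithLp.ofLp_injective 2) (Prod.ext ?_ ?_)
          · change y.snd • g + (y.fst - y.snd • g) = y.fst
            simp
          · change y.snd * 1 + 0 = y.snd
            simp
      · refine sup_le ?_ fun y hy => ?_
        · rw [Submodule.span_singleton_le_iff_mem]
          exact hgM
        · obtain ⟨h1, h2⟩ := hy
          have h1' : y.fst ∈ N := by
            rw [hNφ]
            exact h1
          have h2' : y.snd = 0 := h2
          have e : y = WithLp.toLp 2 (y.fst, (0 : ℂ)) := by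
            rw [← h2']
            rfl
          rw [e]
          exact (hNmem _).1 h1'

end Brownian

/-! ### The bidisc Hardy space as a vector-valued Hardy space -/

section Bidisc

variable {E : Type*} [NormedAddCommGroup E] [InnerProductSpace ℂ E] [CompleteSpace E]

theorem hasSum_norm_sq_bidisc (i : E →ₗᵢ[ℂ] Hardy ℂ) (g : Hardy E) :
    HasSum (fun p : ℕ × ℕ => ‖i (g p.1) p.2‖ ^ 2) (‖g‖ ^ 2) := by
  have hrow : ∀ n, HasSum (fun m => ‖i (g n) m‖ ^ 2) (‖g n‖ ^ 2) := fun n => by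
    rw [← i.norm_map]
    exact hasSum_norm_sq_lp (i (g n))
  have hs : Summable (fun p : ℕ × ℕ => ‖i (g p.1) p.2‖ ^ 2) := by
    refine (summable_prod_of_nonneg fun p => sq_nonneg _).2 ⟨fun n => (hrow n).summable, ?_⟩
    refine (hasSum_norm_sq_lp g).summable.congr fun n => ?_
    exact (hrow n).tsum_eq.symm
  have h := hs.hasSum.prod_fiberwise hrow
  rw [(hasSum_norm_sq_lp g).unique h]
  exact hs.hasSum

/-- For an isometry `i : E → H²(𝔻)`, the function `(z₁, z₂) ↦ (i g(z₁))(z₂)` on the bidisc. -/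
def toBidisc (i : E →ₗᵢ[ℂ] Hardy ℂ) : Hardy E →ₗᵢ[ℂ] HardyBidisc where
  toFun g := ⟨fun p => i (g p.1) p.2, memℓp_two_iff.2 (hasSum_norm_sq_bidisc i g).summable⟩
  map_add' f g := by
    ext p
    change i (f p.1 + g p.1) p.2 = i (f p.1) p.2 + i (g p.1) p.2
    rw [map_add]
    rfl
  map_smul' c f := by
    ext p
    change i (c • f p.1) p.2 = c • i (f p.1) p.2
    rw [map_smul]
    rfl
  norm_map' g := lp_norm_eq_of_norm_eq (hasSum_norm_sq_bidisc i g)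

/-- The function `z₂ ↦ (1 / n!) ∂₁ⁿ F(0, z₂)`, the coefficient of `z₁ⁿ` in `F`. -/
def slice (n : ℕ) : HardyBidisc →ₗ[ℂ] Hardy ℂ where
  toFun F := ⟨fun m => F (n, m), memℓp_two_iff.2
    ((hasSum_norm_sq_lp F).summable.comp_injective (Prod.mk_right_injective n))⟩
  map_add' _ _ := rfl
  map_smul' _ _ := rfl

theorem slice_toBidisc (i : E →ₗᵢ[ℂ] Hardy ℂ) (g : Hardy E) (n : ℕ) :
    slice n (toBidisc i g) = i (g n) := rfl

theorem slice_ext {F G : HardyBidisc} (h : ∀ n, slice n F = slice n G) : F = G := by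
  ext p
  exact congrArg (fun f : Hardy ℂ => f p.2) (h p.1)

theorem norm_slice_le (n : ℕ) (F : HardyBidisc) : ‖slice n F‖ ≤ ‖F‖ := by
  refine (sq_le_sq₀ (norm_nonneg _) (norm_nonneg _)).1 ?_
  have h := hasSum_norm_sq_lp F
  rw [← (hasSum_norm_sq_lp (slice n F)).tsum_eq, ← h.tsum_eq]
  exact (h.summable.comp_injective (Prod.mk_right_injective n)).tsum_le_tsum_of_inj _
    (Prod.mk_right_injective n) (fun _ _ => sq_nonneg _) (fun _ => le_rfl) h.summable

theorem continuous_slice (n : ℕ) : Continuous (slice n) :=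
  ((slice n).mkContinuous 1 fun F => by simpa using norm_slice_le n F).continuous

theorem summable_norm_sq_slice (F : HardyBidisc) : Summable fun n => ‖slice n F‖ ^ 2 := by
  have h := (hasSum_norm_sq_lp F).summable
  refine ((summable_prod_of_nonneg fun p => sq_nonneg _).1 h).2.congr fun n => ?_
  exact (hasSum_norm_sq_lp (slice n F)).tsum_eq

/-- The isometry `i` preserves the norms of slices, so the chosen preimages are again
square-summable. -/
theorem exists_toBidisc_eq (i : E →ₗᵢ[ℂ] Hardy ℂ) (F : HardyBidisc)
    (hF : ∀ n, ∃ e, i e = slice n F) : ∃ g : Hardy E, toBidisc i g = F := by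
  choose e he using hF
  have hmem : Memℓp e 2 := by
    rw [memℓp_two_iff]
    refine (summable_norm_sq_slice F).congr fun n => ?_
    rw [← he, i.norm_map]
  exact ⟨⟨e, hmem⟩, slice_ext fun n => he n⟩

theorem hasSum_inner_slice (F G : HardyBidisc) :
    HasSum (fun n => inner ℂ (slice n F) (slice n G)) (inner ℂ F G) := by
  obtain ⟨f, rfl⟩ := exists_toBidisc_eq LinearIsometry.id F fun n => ⟨_, rfl⟩
  obtain ⟨g, rfl⟩ := exists_toBidisc_eq LinearIsometry.id G fun n => ⟨_, rfl⟩
  rw [LinearIsometry.inner_map_map]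
  exact lp.hasSum_inner f g

theorem bidiscEval_toBidisc (i : E →ₗᵢ[ℂ] Hardy ℂ) (g : Hardy E) {z₁ z₂ : ℂ}
    (h₁ : z₁ ∈ unitDisc) (h₂ : z₂ ∈ unitDisc) :
    bidiscEval (toBidisc i g) z₁ z₂ = hardyEval (i (hardyEval g z₁)) z₂ := by
  have hl := (hardyEval_summable g h₁).hasSum.mapL i.toContinuousLinearMap
  have hr := hasSum_hardyEval hl h₂
  have hb := (bidiscEval_summable (toBidisc i g) h₁ h₂).hasSum.prod_fiberwise fun n =>
    (((hardyEval_summable (i (g n)) h₂).hasSum).const_smul (z₁ ^ n)).congr_fun fun m =>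
      mul_assoc _ _ _
  refine hb.unique (hr.congr_fun fun n => ?_)
  change z₁ ^ n • hardyEval (i (g n)) z₂ = hardyEval (i (z₁ ^ n • g n)) z₂
  rw [map_smul, hardyEval_smul _ _ h₂]

theorem bidiscEval_eq_tsum_slice (F : HardyBidisc) {z₁ z₂ : ℂ} (h₁ : z₁ ∈ unitDisc)
    (h₂ : z₂ ∈ unitDisc) :
    bidiscEval F z₁ z₂ = ∑' n : ℕ, z₁ ^ n • hardyEval (slice n F) z₂ := by
  have hb := (bidiscEval_summable F h₁ h₂).hasSum.prod_fiberwise fun n =>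
    (((hardyEval_summable (slice n F) h₂).hasSum).const_smul (z₁ ^ n)).congr_fun fun m =>
      mul_assoc _ _ _
  exact hb.tsum_eq.symm

theorem norm_hardyEval_slice_le (F : HardyBidisc) {z : ℂ} (hz : z ∈ unitDisc) (n : ℕ) :
    ‖hardyEval (slice n F) z‖ ≤ ‖symbol (LinearIsometry.id (R := ℂ) (E := Hardy ℂ)) z‖ * ‖F‖ := by
  have := (symbol (LinearIsometry.id (R := ℂ) (E := Hardy ℂ)) z).le_opNorm (slice n F)
  rw [symbol_apply _ hz] at this
  exact this.trans (by gcongr; exact norm_slice_le n F)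

/-- The coefficients in `z₁` of functions of the form `F(z₁, z₂) = ∑ z₁ⁿ fₙ(z₂)` are unique. -/
theorem hardyEval_slice_eq {F : HardyBidisc} {z₂ : ℂ} (h₂ : z₂ ∈ unitDisc) {c : ℕ → ℂ} {C : ℝ}
    (hc : ∀ n, ‖c n‖ ≤ C)
    (h : ∀ z₁ ∈ unitDisc, bidiscEval F z₁ z₂ = ∑' n : ℕ, z₁ ^ n • c n) (n : ℕ) :
    hardyEval (slice n F) z₂ = c n :=
  congrFun (coeff_eq_of_tsum_pow_smul_eq (norm_hardyEval_slice_le F h₂) hc fun z₁ h₁ => by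
    rw [← h z₁ h₁, bidiscEval_eq_tsum_slice F h₁ h₂]) n

theorem bidiscEval_ext {F G : HardyBidisc}
    (h : ∀ z₁ ∈ unitDisc, ∀ z₂ ∈ unitDisc, bidiscEval F z₁ z₂ = bidiscEval G z₁ z₂) : F = G :=
  slice_ext fun n => hardyEval_ext fun _ h₂ =>
    hardyEval_slice_eq h₂ (norm_hardyEval_slice_le G h₂)
      (fun z₁ h₁ => by rw [h z₁ h₁ _ h₂, bidiscEval_eq_tsum_slice G h₁ h₂]) n

theorem slice_mulZ₁_zero (F : HardyBidisc) : slice 0 (mulZ₁ F) = 0 := by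
  ext m
  exact coeffPush_apply_of_notMem (fun p : ℕ × ℕ => (p.1 + 1, p.2))
    (by rintro ⟨a, b⟩ ⟨c, d⟩ h; simpa using h) F (0, m) (by simp)

theorem slice_mulZ₁_succ (F : HardyBidisc) (n : ℕ) : slice (n + 1) (mulZ₁ F) = slice n F := by
  ext m
  exact coeffPush_apply (fun p : ℕ × ℕ => (p.1 + 1, p.2))
    (by rintro ⟨a, b⟩ ⟨c, d⟩ h; simpa using h) F (n, m)

theorem toBidisc_hardyShift (i : E →ₗᵢ[ℂ] Hardy ℂ) (g : Hardy E) :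
    toBidisc i (hardyShift E g) = mulZ₁ (toBidisc i g) := by
  refine slice_ext fun n => ?_
  cases n with
  | zero => rw [slice_mulZ₁_zero, slice_toBidisc, hardyShift_apply_zero, map_zero]
  | succ n => rw [slice_mulZ₁_succ, slice_toBidisc, hardyShift_apply_succ, slice_toBidisc]

theorem toBidisc_single_zero (f : Hardy ℂ) :
    toBidisc LinearIsometry.id (lp.single 2 0 f) = embedJ f := by
  refine slice_ext fun n => ?_
  rw [slice_toBidisc]
  ext m
  have hinj : Function.Injective fun n : ℕ => ((0 : ℕ), n) := Prod.mk_right_injective 0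
  change (lp.single 2 0 f : Hardy (Hardy ℂ)) n m = coeffPush _ hinj f (n, m)
  cases n with
  | zero =>
    rw [coeffPush_apply _ hinj f m]
    simp
  | succ n =>
    rw [coeffPush_apply_of_notMem _ hinj f (n + 1, m) (by simp)]
    simp

/-! ### Subspaces determined by their slices -/

/-- The functions all of whose coefficients in `z₁` lie in `A`. -/
def sliceSubspace (A : Submodule ℂ (Hardy ℂ)) : Submodule ℂ HardyBidisc :=
  ⨅ n, A.comap (slice n)

variable {A B : Submodule ℂ (Hardy ℂ)} {M : Submodule ℂ HardyBidisc}

theorem mem_sliceSubspace {F : HardyBidisc} : F ∈ sliceSubspace A ↔ ∀ n, slice n F ∈ A := by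
  simp [sliceSubspace]

theorem isClosed_sliceSubspace (hA : IsClosed (A : Set (Hardy ℂ))) :
    IsClosed (sliceSubspace A : Set HardyBidisc) := by
  have : (sliceSubspace A : Set HardyBidisc) = ⋂ n, slice n ⁻¹' A := by
    ext F
    simp [mem_sliceSubspace]
  rw [this]
  exact isClosed_iInter fun n => hA.preimage (continuous_slice n)

theorem mulZ₁_mem_sliceSubspace {F : HardyBidisc} (hF : F ∈ sliceSubspace A) :
    mulZ₁ F ∈ sliceSubspace A := by
  rw [mem_sliceSubspace] at hF ⊢
  intro n
  cases n with
  | zero => rw [slice_mulZ₁_zero]; exact A.zero_mem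
  | succ n => rw [slice_mulZ₁_succ]; exact hF n

theorem isOrtho_sliceSubspace (h : A ⟂ B) : sliceSubspace A ⟂ sliceSubspace B := by
  rw [Submodule.isOrtho_iff_inner_eq] at h ⊢
  intro F hF G hG
  rw [mem_sliceSubspace] at hF hG
  refine (hasSum_inner_slice F G).unique ?_
  simp only [h _ (hF _) _ (hG _)]
  exact hasSum_zero

/-- Testing against `z₁ⁿ a(z₂)` with `a ∈ A` isolates the `n`-th slice. In particular the complement
is itself `z₁`-invariant. -/
theorem orthogonal_sliceSubspace : (sliceSubspace A)ᗮ = sliceSubspace Aᗮ := by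
  refine le_antisymm (fun F hF => ?_) ?_
  · rw [mem_sliceSubspace]
    intro n
    rw [Submodule.mem_orthogonal]
    intro a ha
    obtain ⟨f, rfl⟩ := exists_toBidisc_eq LinearIsometry.id F fun n => ⟨_, rfl⟩
    have h1 : toBidisc LinearIsometry.id (lp.single 2 n a) ∈ sliceSubspace A := by
      rw [mem_sliceSubspace]
      intro m
      rw [slice_toBidisc]
      change (lp.single 2 n a : Hardy (Hardy ℂ)) m ∈ A
      by_cases hm : m = n
      · subst hm
        simpa using ha
      · rw [lp.single_apply_ne _ _ _ hm]
        exact A.zero_mem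
    have h2 := (Submodule.mem_orthogonal _ _).1 hF _ h1
    rwa [LinearIsometry.inner_map_map, lp.inner_single_left] at h2
  · exact (Submodule.isOrtho_iff_le.1 (isOrtho_sliceSubspace A.isOrtho_orthogonal_right.symm))

/-- A closed subspace invariant under multiplication by `z₁` that contains `J A` contains every
function with slices in `A`. -/
theorem sliceSubspace_le (hMc : IsClosed (M : Set HardyBidisc)) (hM : ∀ F ∈ M, mulZ₁ F ∈ M)
    (hJ : ∀ f ∈ A, embedJ f ∈ M) : sliceSubspace A ≤ M := by
  intro F hF
  rw [mem_sliceSubspace] at hF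
  obtain ⟨f, rfl⟩ := exists_toBidisc_eq LinearIsometry.id F fun n => ⟨_, rfl⟩
  -- The functions `z₁ⁿ a(z₂)` arise from `J a` by repeated multiplication by `z₁`; their sums
  -- converge to `F`.
  have hsingle : ∀ n, ∀ a ∈ A, toBidisc LinearIsometry.id (lp.single 2 n a) ∈ M := by
    intro n
    induction n with
    | zero =>
      intro a ha
      rw [toBidisc_single_zero]
      exact hJ a ha
    | succ n ih =>
      intro a ha
      rw [← hardyShift_single, toBidisc_hardyShift]
      exact hM _ (ih a ha)
  have hs := (lp.hasSum_single (by norm_num) f).mapL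
    (toBidisc (LinearIsometry.id (R := ℂ) (E := Hardy ℂ))).toContinuousLinearMap
  refine hMc.mem_of_tendsto hs.tendsto_sum_nat (Filter.Eventually.of_forall fun n => ?_)
  exact M.sum_mem fun k _ => hsingle k _ (hF k)

/-- Forwards, compare coefficients in `z₁` at fixed `z₂`; backwards, divide each slice by `φ`, which
preserves norms because `φ` is inner. -/
theorem mulBidisc_eq_sliceSubspace {φ : ℂ → ℂ} (hφ : IsScalarInner φ) :
    mulBidisc φ = sliceSubspace (mulHardy φ) := by
  obtain ⟨V, hV, hr, -⟩ := hφ.exists_linearIsometry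
  ext F
  rw [mem_sliceSubspace]
  constructor
  · rintro ⟨G, hG⟩ n
    refine ⟨slice n G, fun z hz => ?_⟩
    refine hardyEval_slice_eq (c := fun n => φ z * hardyEval (slice n G) z)
      (C := ‖φ z‖ * (‖symbol (LinearIsometry.id (R := ℂ) (E := Hardy ℂ)) z‖ * ‖G‖)) hz (fun n => ?_)
      (fun z₁ h₁ => ?_) n
    · rw [norm_mul]
      exact mul_le_mul_of_nonneg_left (norm_hardyEval_slice_le G hz n) (norm_nonneg _)
    · rw [hG z₁ h₁ z hz, bidiscEval_eq_tsum_slice G h₁ hz, ← tsum_mul_left]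
      exact tsum_congr fun n => mul_smul_comm _ _ _
  · intro hF
    obtain ⟨g, rfl⟩ := exists_toBidisc_eq V F fun n => by
      have := hF n
      rwa [← hr] at this
    refine ⟨toBidisc LinearIsometry.id g, fun z₁ h₁ z₂ h₂ => ?_⟩
    rw [bidiscEval_toBidisc _ _ h₁ h₂, bidiscEval_toBidisc _ _ h₁ h₂, hV _ z₂ h₂]
    rfl

theorem mulHardyZ₁_eq_sliceSubspace (g : Hardy ℂ) : mulHardyZ₁ g = sliceSubspace (ℂ ∙ g) := by
  ext F
  rw [mem_sliceSubspace]
  constructor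
  · rintro ⟨h, hh⟩ n
    refine Submodule.mem_span_singleton.2 ⟨h n, hardyEval_ext fun z hz => ?_⟩
    rw [hardyEval_smul _ _ hz, smul_eq_mul]
    refine (hardyEval_slice_eq (c := fun n => h n * hardyEval g z)
      (C := ‖h‖ * ‖hardyEval g z‖) hz (fun n => ?_)
      (fun z₁ h₁ => ?_) n).symm
    · rw [norm_mul]
      exact mul_le_mul_of_nonneg_right (lp.norm_apply_le_norm (by norm_num) h n) (norm_nonneg _)
    · rw [hh z₁ h₁ z hz, hardyEval, hardyEval, ← tsum_mul_left]
      refine tsum_congr fun n => ?_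
      simp only [smul_eq_mul]
      ring
  · intro hF
    by_cases hg : g = 0
    · refine ⟨0, ?_⟩
      have : F = 0 := slice_ext fun n => by
        have := hF n
        rw [hg, Submodule.span_zero_singleton, Submodule.mem_bot] at this
        rw [this, map_zero]
      intro z₁ _ z₂ _
      rw [this, bidiscEval_zero, hardyEval_zero, mul_zero]
    -- Normalising `g` makes `c ↦ c g / ‖g‖` an isometry of `ℂ`, so the coefficients of `h` are
    -- square-summable; the factor `‖g‖⁻¹` is returned to `h` afterwards.
    · have hu : ‖((‖g‖ : ℂ)⁻¹) • g‖ = 1 := by simpa using norm_smul_inv_norm (𝕜 := ℂ) hg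
      have hg0 : (‖g‖ : ℂ) ≠ 0 := by simpa using hg
      obtain ⟨h, rfl⟩ := exists_toBidisc_eq (LinearIsometry.toSpanSingleton ℂ (Hardy ℂ) hu) F
        fun n => by
          obtain ⟨c, hc⟩ := Submodule.mem_span_singleton.1 (hF n)
          refine ⟨c * ‖g‖, ?_⟩
          change (c * ‖g‖) • ((‖g‖ : ℂ)⁻¹) • g = _
          rw [smul_smul, mul_assoc, mul_inv_cancel₀ hg0, mul_one, hc]
      refine ⟨((‖g‖ : ℂ)⁻¹) • h, fun z₁ h₁ z₂ h₂ => ?_⟩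
      rw [bidiscEval_toBidisc _ _ h₁ h₂, hardyEval_smul _ _ h₁]
      change hardyEval (hardyEval h z₁ • ((‖g‖ : ℂ)⁻¹) • g) z₂ = _
      rw [smul_smul, hardyEval_smul _ _ h₂]
      simp only [smul_eq_mul]
      ring

/-- The Beurling–Lax–Halmos theorem for subspaces of `H²(𝔻; K)` seen inside `H²(𝔻²)`. -/
theorem exists_eq_mulVector (K : Submodule ℂ (Hardy ℂ)) (hK : IsClosed (K : Set (Hardy ℂ)))
    (hMc : IsClosed (M : Set HardyBidisc)) (hM : ∀ F ∈ M, mulZ₁ F ∈ M)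
    (hMK : M ≤ sliceSubspace K) :
    ∃ (E : Type) (_ : NormedAddCommGroup E) (_ : InnerProductSpace ℂ E) (_ : CompleteSpace E)
      (Ψ : ℂ → E →L[ℂ] K), IsInnerFunction Ψ ∧ M = mulVector Ψ := by
  have : CompleteSpace K := hK.completeSpace_coe
  set T := toBidisc K.subtypeₗᵢ with hT
  set N : Submodule ℂ (Hardy K) := M.comap T.toLinearMap with hN
  have hNc : IsClosed (N : Set (Hardy K)) := hMc.preimage T.continuous
  have hNS : ∀ f ∈ N, hardyShift K f ∈ N := by
    intro f hf
    change T (hardyShift K f) ∈ M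
    rw [hT, toBidisc_hardyShift]
    exact hM _ hf
  obtain ⟨W, hWc, Ψ, V, hΨ, hVr, hV⟩ := exists_isInnerFunction_range_eq N hNc hNS
  refine ⟨W, inferInstance, inferInstance, hWc, Ψ, hΨ, ?_⟩
  have heval : ∀ h : Hardy W, ∀ z₁ ∈ unitDisc, ∀ z₂ ∈ unitDisc, bidiscEval (T (V h)) z₁ z₂
      = hardyEval (Ψ z₁ (hardyEval h z₁) : Hardy ℂ) z₂ := by
    intro h z₁ h₁ z₂ h₂
    rw [hT, bidiscEval_toBidisc _ _ h₁ h₂, hV h z₁ h₁]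
    rfl
  ext F
  constructor
  · intro hF
    obtain ⟨f, rfl⟩ := exists_toBidisc_eq K.subtypeₗᵢ F fun n =>
      ⟨⟨_, mem_sliceSubspace.1 (hMK hF) n⟩, rfl⟩
    have hf : f ∈ N := hF
    rw [← hVr] at hf
    obtain ⟨h, rfl⟩ := hf
    exact ⟨h, heval h⟩
  · rintro ⟨h, hh⟩
    have : F = T (V h) := bidiscEval_ext fun z₁ h₁ z₂ h₂ => by
      rw [hh z₁ h₁ z₂ h₂, heval h z₁ h₁ z₂ h₂]
    rw [this]
    have hVN : V h ∈ N := by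
      rw [← hVr]
      exact ⟨h, rfl⟩
    exact hVN

/-- The values of an inner function at the origin occur as functions of `z₂` in `Ψ H²(𝔻; E)`. -/
theorem exists_mem_mulVector_slice_zero {K : Submodule ℂ (Hardy ℂ)}
    (hK : IsClosed (K : Set (Hardy ℂ))) {Ψ : ℂ → E →L[ℂ] K} (hΨ : IsInnerFunction Ψ) (e : E) :
    ∃ F ∈ mulVector Ψ, slice 0 F = (Ψ 0 e : Hardy ℂ) := by
  have : CompleteSpace K := hK.completeSpace_coe
  obtain ⟨V, hV⟩ := hΨ.exists_linearIsometry
  -- Multiply the constant function `e` by `Ψ`; the zeroth slice is the value at `z₁ = 0`.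
  refine ⟨toBidisc K.subtypeₗᵢ (V (lp.single 2 0 e)), ⟨lp.single 2 0 e, fun z₁ h₁ z₂ h₂ => ?_⟩, ?_⟩
  · rw [bidiscEval_toBidisc _ _ h₁ h₂, hV _ z₁ h₁]
    rfl
  · have h0 : (0 : ℂ) ∈ unitDisc := by simp
    rw [slice_toBidisc, ← hardyEval_at_zero, hV _ 0 h0, hardyEval_at_zero]
    simp

end Bidisc

/-! ### Invariant subspaces of the 3-Brownian shift -/

section ThreeBrownian

variable {σ θ : ℝ} {M₀ : Submodule ℂ HardyBidisc} {M₁ : Submodule ℂ BrownianSpace}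

theorem isClosed_of_isClosed_hilbertProd
    (h : IsClosed (hilbertProd M₀ M₁ : Set ThreeBrownianSpace)) :
    IsClosed (M₀ : Set HardyBidisc) := by
  let ι : HardyBidisc →L[ℂ] ThreeBrownianSpace :=
    (WithLp.prodContinuousLinearEquiv 2 ℂ HardyBidisc BrownianSpace).symm.toContinuousLinearMap ∘L
      ContinuousLinearMap.inl ℂ HardyBidisc BrownianSpace
  have : (M₀ : Set HardyBidisc) = ι ⁻¹' (hilbertProd M₀ M₁ : Set ThreeBrownianSpace) := by
    ext F
    exact ⟨fun hF => ⟨hF, M₁.zero_mem⟩, fun hF => hF.1⟩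
  rw [this]
  exact h.preimage ι.continuous

theorem mulZ₁_mem_of_invariant
    (h : ∀ x ∈ hilbertProd M₀ M₁, threeBrownianShift σ θ x ∈ hilbertProd M₀ M₁) :
    ∀ F ∈ M₀, mulZ₁ F ∈ M₀ := by
  intro F hF
  have h1 : WithLp.toLp 2 (F, WithLp.toLp 2 ((0 : Hardy ℂ), (0 : ℂ))) ∈ hilbertProd M₀ M₁ :=
    ⟨hF, M₁.zero_mem⟩
  have h2 := h _ h1
  rw [threeBrownianShift_apply, map_zero, smul_zero, add_zero] at h2
  exact h2.1

/-- The image of `(0, f, α)` has first component `σ J f`, and `σ ≠ 0`. This is the only way `M₁`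
constrains `M₀`. -/
theorem embedJ_mem_of_invariant (hσ : 0 < σ)
    (h : ∀ x ∈ hilbertProd M₀ M₁, threeBrownianShift σ θ x ∈ hilbertProd M₀ M₁) {f : Hardy ℂ}
    {α : ℂ} (hf : WithLp.toLp 2 (f, α) ∈ M₁) : embedJ f ∈ M₀ := by
  have h1 : WithLp.toLp 2 ((0 : HardyBidisc), WithLp.toLp 2 (f, α)) ∈ hilbertProd M₀ M₁ :=
    ⟨M₀.zero_mem, hf⟩
  have h2 := h _ h1
  rw [threeBrownianShift_apply, map_zero, zero_add] at h2
  have h3 : (σ : ℂ) • embedJ f ∈ M₀ := h2.1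
  have hσ0 : (σ : ℂ) ≠ 0 := by exact_mod_cast hσ.ne'
  exact (M₀.smul_mem_iff hσ0).1 h3

theorem mem_typeISubspace {φ : ℂ → ℂ} {f : Hardy ℂ} (hf : f ∈ mulHardy φ) :
    WithLp.toLp 2 (f, (0 : ℂ)) ∈ typeISubspace φ :=
  ⟨hf, rfl⟩

end ThreeBrownian

end

theorem theorem2p1 (σ θ : ℝ) (hσ : 0 < σ) (hθ : θ ∈ Set.Ico 0 (2 * Real.pi))
    (M₀ : Submodule ℂ HardyBidisc) (M₁ : Submodule ℂ BrownianSpace)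
    (hM : IsInvariantSubspace (threeBrownianShift σ θ) (hilbertProd M₀ M₁))
    (hM₁ : IsInvariantSubspace (brownianShift σ θ) M₁) (hne : M₁ ≠ ⊥) :
    ((∃ φ : ℂ → ℂ, IsScalarInner φ ∧ M₁ = typeISubspace φ) ∨
      (∃ (φ : ℂ → ℂ) (g : Hardy ℂ),
        IsScalarInner φ ∧ IsTypeIIPair σ θ φ g ∧ M₁ = typeIISubspace φ g)) ∧
    (∀ φ : ℂ → ℂ, IsScalarInner φ → M₁ = typeISubspace φ →
      ∃ (E : Type) (_ : NormedAddCommGroup E) (_ : InnerProductSpace ℂ E) (_ : CompleteSpace E)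
        (Ψ : ℂ → E →L[ℂ] modelSpace φ),
        IsInnerFunction Ψ ∧
        mulBidisc φ ⟂ mulVector Ψ ∧
        M₀ = mulBidisc φ ⊔ mulVector Ψ) ∧
    (∀ (φ : ℂ → ℂ) (g : Hardy ℂ), IsScalarInner φ → IsTypeIIPair σ θ φ g →
      M₁ = typeIISubspace φ g →
      g ∈ modelSpace φ ∧
      ∃ (E : Type) (_ : NormedAddCommGroup E) (_ : InnerProductSpace ℂ E) (_ : CompleteSpace E)
        (Ψ : ℂ → E →L[ℂ] modelSpace φ),
        IsInnerFunction Ψ ∧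
        mulBidisc φ ⟂ mulHardyZ₁ g ∧
        mulBidisc φ ⟂ mulVector Ψ ∧
        mulHardyZ₁ g ⟂ mulVector Ψ ∧
        M₀ = mulBidisc φ ⊔ mulHardyZ₁ g ⊔ mulVector Ψ ∧
        ∀ e : E, inner ℂ g (Ψ 0 e : Hardy ℂ) = 0) := by
  obtain ⟨hMc, hMT⟩ := hM
  have hM₀c := isClosed_of_isClosed_hilbertProd hMc
  have hM₀z := mulZ₁_mem_of_invariant hMT
  refine ⟨brownianShift_invariant_classification hσ hM₁ hne, fun φ hφ h₁ => ?_,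
    fun φ g hφ hg h₁ => ?_⟩
  · have hP : IsClosed (sliceSubspace (mulHardy φ) : Set HardyBidisc) :=
      isClosed_sliceSubspace (isClosed_mulHardy hφ)
    have hPM : sliceSubspace (mulHardy φ) ≤ M₀ :=
      sliceSubspace_le hM₀c hM₀z fun f hf =>
        embedJ_mem_of_invariant hσ hMT (h₁ ▸ mem_typeISubspace hf)
    -- Apply Beurling–Lax–Halmos to `M₀ ⊖ φ_{z₂} H²(𝔻²)`, whose slices lie in `K_φ`.
    obtain ⟨E, i₁, i₂, i₃, Ψ, hΨ, hMΨ⟩ := exists_eq_mulVector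
      (M := (sliceSubspace (mulHardy φ))ᗮ ⊓ M₀) (modelSpace φ)
      (Submodule.isClosed_orthogonal _) ((Submodule.isClosed_orthogonal _).inter hM₀c)
      (fun F hF => ⟨by
        have h := hF.1
        rw [SetLike.mem_coe, orthogonal_sliceSubspace] at h ⊢
        exact mulZ₁_mem_sliceSubspace h, hM₀z F hF.2⟩)
      (by
        rw [orthogonal_sliceSubspace]
        exact inf_le_left)
    refine ⟨E, i₁, i₂, i₃, Ψ, hΨ, ?_, ?_⟩
    · rw [← hMΨ, mulBidisc_eq_sliceSubspace hφ]
      exact (Submodule.isOrtho_orthogonal_right _).mono_right inf_le_left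
    · have := hP.completeSpace_coe
      rw [← hMΨ, mulBidisc_eq_sliceSubspace hφ,
        Submodule.sup_orthogonal_inf_of_hasOrthogonalProjection hPM]
  · have hgK := hg.mem_modelSpace hφ
    refine ⟨hgK, ?_⟩
    have hP : IsClosed (sliceSubspace (mulHardy φ) : Set HardyBidisc) :=
      isClosed_sliceSubspace (isClosed_mulHardy hφ)
    have hQ : IsClosed (sliceSubspace (ℂ ∙ g) : Set HardyBidisc) :=
      isClosed_sliceSubspace (ℂ ∙ g).closed_of_finiteDimensional
    have hPM : sliceSubspace (mulHardy φ) ≤ M₀ :=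
      sliceSubspace_le hM₀c hM₀z fun f hf =>
        embedJ_mem_of_invariant hσ hMT (by
          rw [h₁]
          exact Submodule.mem_sup_right (mem_typeISubspace hf))
    have hQM : sliceSubspace (ℂ ∙ g) ≤ M₀ :=
      sliceSubspace_le hM₀c hM₀z fun f hf => by
        obtain ⟨c, rfl⟩ := Submodule.mem_span_singleton.1 hf
        rw [map_smul]
        refine M₀.smul_mem c (embedJ_mem_of_invariant hσ hMT (α := 1) ?_)
        rw [h₁]
        exact Submodule.mem_sup_left (Submodule.mem_span_singleton_self _)
    have hPQ : sliceSubspace (mulHardy φ) ⟂ sliceSubspace (ℂ ∙ g) := by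
      refine isOrtho_sliceSubspace (Submodule.isOrtho_iff_le.2 ?_).symm
      rwa [Submodule.span_singleton_le_iff_mem]
    -- Here `g_{z₂} H²_{z₁}` is removed as well. The nested intersection lets the orthogonal
    -- splitting be applied twice, first inside `M₀ ⊖ φ_{z₂} H²(𝔻²)` and then inside `M₀`.
    obtain ⟨E, i₁, i₂, i₃, Ψ, hΨ, hMΨ⟩ := exists_eq_mulVector
      (M := (sliceSubspace (ℂ ∙ g))ᗮ ⊓ ((sliceSubspace (mulHardy φ))ᗮ ⊓ M₀)) (modelSpace φ)
      (Submodule.isClosed_orthogonal _) ((Submodule.isClosed_orthogonal _).inter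
        ((Submodule.isClosed_orthogonal _).inter hM₀c))
      (fun F hF => ⟨by
        have h := hF.1
        rw [SetLike.mem_coe, orthogonal_sliceSubspace] at h ⊢
        exact mulZ₁_mem_sliceSubspace h, by
        have h := hF.2.1
        rw [SetLike.mem_coe, orthogonal_sliceSubspace] at h ⊢
        exact mulZ₁_mem_sliceSubspace h, hM₀z F hF.2.2⟩)
      (by
        rw [orthogonal_sliceSubspace (A := mulHardy φ)]
        exact inf_le_right.trans inf_le_left)
    have hQΨ : mulHardyZ₁ g ⟂ mulVector Ψ := by
      rw [← hMΨ, mulHardyZ₁_eq_sliceSubspace]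
      exact (Submodule.isOrtho_orthogonal_right _).mono_right inf_le_left
    refine ⟨E, i₁, i₂, i₃, Ψ, hΨ, ?_, ?_, hQΨ, ?_, fun e => ?_⟩
    · rwa [mulBidisc_eq_sliceSubspace hφ, mulHardyZ₁_eq_sliceSubspace]
    · rw [← hMΨ, mulBidisc_eq_sliceSubspace hφ]
      exact (Submodule.isOrtho_orthogonal_right _).mono_right (inf_le_right.trans inf_le_left)
    · have := hP.completeSpace_coe
      have := hQ.completeSpace_coe
      rw [← hMΨ, mulBidisc_eq_sliceSubspace hφ, mulHardyZ₁_eq_sliceSubspace, sup_assoc,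
        Submodule.sup_orthogonal_inf_of_hasOrthogonalProjection
          (le_inf (Submodule.isOrtho_iff_le.1 hPQ.symm) hQM),
        Submodule.sup_orthogonal_inf_of_hasOrthogonalProjection hPM]
    -- Orthogonality to `g_{z₂} H²_{z₁}` holds slice by slice, and `Ψ(0) e` is a zeroth slice.
    · obtain ⟨F, hF, hF0⟩ := exists_mem_mulVector_slice_zero
        (Submodule.isClosed_orthogonal _) hΨ e
      have h : F ∈ (sliceSubspace (ℂ ∙ g))ᗮ := by
        rw [← hMΨ] at hF
        exact hF.1
      rw [orthogonal_sliceSubspace, mem_sliceSubspace] at h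
      rw [← hF0]
      exact (Submodule.mem_orthogonal _ _).1 (h 0) g (Submodule.mem_span_singleton_self _)
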